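/- Let $\{0,1\}^n$ be the set of binary strings of length $n$, let $d_H$ be the Hamming distance on it, and let $\overline{c}$ be the bitwise complement of a string $c$. For $n\ge 2$, the $n$-dimensional hierarchical cubic network $HCN_n$ is the simple graph whose vertices are the pairs $x=\langle c(x),p(x)\rangle$ with $c(x),p(x)\in\{0,1\}^n$, where two vertices $x$ and $y$ are adjacent if and only if one of the following holds: (1) $c(x)=c(y)$ and $d_H(p(x),p(y))=1$; (2) $c(x)\ne c(y)$, $c(x)=p(x)$ and $c(y)=p(y)=\overline{c(x)}$; (3) $c(x)\ne c(y)$, $c(x)\ne p(x)$, $c(x)=p(y)$ and $p(x)=c(y)$. For a graph $G$ and a set $S\subseteq V(G)$, an $S$-tree is a tree $T$ that is a subgraph of $G$ with $S\subseteq V(T)$. The $S$-trees $T_1,\dots,T_r$ are internally edge disjoint if $V(T_i)\cap V(T_j)=S$ and $E(T_i)\cap E(T_j)=\emptyset$ for all $i\ne j$. Let $\kappa_G(S)$ be the maximum number of internally edge disjoint $S$-trees in $G$, and for $2\le k\le |V(G)|$ let $$\kappa_k(G)=\min\{\kappa_G(S) : S\subseteq V(G),\ |S|=k\}.$$ Corollary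 4.2. For every integer $n\ge 2$, $\kappa_3(HCN_n)=n$. -/

import Mathlib

/-- `IsInternallyDisjointTrees G S T` says that `T 0, …, T (r-1)` are internally edge disjoint
`S`-trees of `G`: each `T i` is a subgraph of `G` that is a tree with `S ⊆ V(T i)`, and
`V(T i) ∩ V(T j) = S` and `E(T i) ∩ E(T j) = ∅` whenever `i ≠ j`. -/
structure IsInternallyDisjointTrees {V : Type*} (G : SimpleGraph V) (S : Set V) {r : ℕ}
    (T : Fin r → G.Subgraph) : Prop where
  isTree : ∀ i, (T i).coe.IsTree
  subset_verts : ∀ i, S ⊆ (T i).verts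
  verts_inter : ∀ i j, i ≠ j → (T i).verts ∩ (T j).verts = S
  edgeSet_inter : ∀ i j, i ≠ j → (T i).edgeSet ∩ (T j).edgeSet = ∅

/-- `κ_G(S)`, the maximum number of internally edge disjoint `S`-trees of `G`. It takes values in
`ℕ∞`, so that an unbounded family of numbers would give `⊤`; a finite value is attained. -/
noncomputable def treeConnectivity {V : Type*} (G : SimpleGraph V) (S : Set V) : ℕ∞ :=
  ⨆ (r : ℕ) (_ : ∃ T : Fin r → G.Subgraph, IsInternallyDisjointTrees G S T), (r : ℕ∞)

/-- The generalized `k`-connectivity `κ_k(G)`, the minimum of `κ_G(S)` over all vertex sets `S`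
with exactly `k` elements (for `2 ≤ k ≤ |V(G)|`; if there is no such set, the value is `⊤`). -/
noncomputable def generalizedConnectivity {V : Type*} (G : SimpleGraph V) (k : ℕ) : ℕ∞ :=
  ⨅ (S : Finset V) (_ : S.card = k), treeConnectivity G (S : Set V)

/-- Binary strings of length `n`. -/
abbrev BinString (n : ℕ) : Type := Fin n → Bool

/-- The bitwise complement of a binary string. -/
def BinString.compl {n : ℕ} (c : BinString n) : BinString n := fun i => !(c i)

/-- The adjacency of the hierarchical cubic network: vertices are pairs `x = ⟨c(x), p(x)⟩` of binary
strings, with `c(x) = x.1` the cluster and `p(x) = x.2` the position within the cluster. -/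
def HCNAdj (n : ℕ) (x y : BinString n × BinString n) : Prop :=
  (x.1 = y.1 ∧ hammingDist x.2 y.2 = 1) ∨
  (x.1 ≠ y.1 ∧ x.1 = x.2 ∧ y.1 = y.2 ∧ y.2 = BinString.compl x.1) ∨
  (x.1 ≠ y.1 ∧ x.1 ≠ x.2 ∧ x.1 = y.2 ∧ x.2 = y.1)

/-- The complement of a binary string is an involution. -/
theorem BinString.compl_compl {n : ℕ} (c : BinString n) :
    BinString.compl (BinString.compl c) = c := by
  funext i
  simp [BinString.compl]

/-- The adjacency of the hierarchical cubic network is symmetric. -/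
theorem HCNAdj.symm {n : ℕ} {x y : BinString n × BinString n} (h : HCNAdj n x y) :
    HCNAdj n y x := by
  rcases h with ⟨h1, h2⟩ | ⟨h1, h2, h3, h4⟩ | ⟨h1, h2, h3, h4⟩
  · exact Or.inl ⟨h1.symm, by rw [hammingDist_comm]; exact h2⟩
  · refine Or.inr (Or.inl ⟨h1.symm, h3, h2, ?_⟩)
    rw [h3, h4, BinString.compl_compl, ← h2]
  · refine Or.inr (Or.inr ⟨h1.symm, ?_, h4.symm, h3.symm⟩)
    rw [← h3, ← h4]
    exact h2.symm

/-- The adjacency of the hierarchical cubic network is irreflexive. -/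
theorem HCNAdj.irrefl {n : ℕ} (x : BinString n × BinString n) : ¬ HCNAdj n x x := by
  rintro (⟨_, h⟩ | ⟨h, _⟩ | ⟨h, _⟩)
  · simp at h
  · exact h rfl
  · exact h rfl

/-- The `n`-dimensional hierarchical cubic network `HCN_n`. -/
def HCN (n : ℕ) : SimpleGraph (BinString n × BinString n) where
  Adj := HCNAdj n
  symm := ⟨fun _ _ h => h.symm⟩
  loopless := ⟨HCNAdj.irrefl⟩

/-! Upper bound. Every vertex has at most n + 1 neighbours. If S contains adjacent vertices x, y and
a third vertex, then n + 1 edge disjoint S-trees would use exactly one edge each at x and at y. The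
tree containing the edge xy would then have no other edge at x or y and could not reach the third
vertex (`treeConnectivity_le_of_adj`).

Lower bound. Connected subgraphs may replace trees, since spanning trees can be taken at the end
(`IsConnectedPacking.le_treeConnectivity`). The hypercube stays connected after the removal of fewer
than n vertices, so Menger's theorem gives fans from a vertex to n targets, and n subgraphs joining
two vertices with distinct representatives. Each cluster is a hypercube, any two clusters are joined
by an edge, and the construction depends on how many clusters S meets. One cluster: the cube carries
n - 1 subgraphs (`hypercube.exists_packing`); one more runs through all other clusters, entered by
the external edges of the three vertices. Two clusters: n subgraphs join the two vertices in the
first cluster; their representatives leave it through distinct intermediate clusters (or by the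
direct edge) and reach the third vertex by a fan. Three clusters: each of n further clusters is a
hub with a link to each of the three, and fans finish inside them. This needs n + 3 ≤ 2 ^ n, hence 3
≤ n. For n = 2 only one further cluster u exists. It is one hub; the second hub is the cluster
labelled by the complement of u, which is itself one of the three and is doubly linked to u, by a
swap edge and a diagonal edge.

The pieces are glued by `IsConnectedPacking.sup`: on every cluster of S, the part of the i-th
subgraph built so far touches that cluster in a single vertex. -/

/-! ### Walks avoiding a vertex set -/

/-- `v` can be reached from `u` by a walk of `G` that avoids the set `X`. -/
def SimpleGraph.ReachableAvoiding {V : Type*} (G : SimpleGraph V) (X : Set V) (u v : V) : Prop :=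
  ∃ w : G.Walk u v, ∀ s ∈ w.support, s ∉ X

namespace SimpleGraph.ReachableAvoiding

variable {V : Type*} {G : SimpleGraph V} {X : Set V} {u v w : V}

theorem refl (h : u ∉ X) : G.ReachableAvoiding X u u := ⟨.nil, by simpa using h⟩

theorem symm (h : G.ReachableAvoiding X u v) : G.ReachableAvoiding X v u := by
  obtain ⟨p, hp⟩ := h
  exact ⟨p.reverse, by simpa using hp⟩

theorem trans (h : G.ReachableAvoiding X u v) (h' : G.ReachableAvoiding X v w) :
    G.ReachableAvoiding X u w := by
  obtain ⟨p, hp⟩ := h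
  obtain ⟨q, hq⟩ := h'
  refine ⟨p.append q, fun s hs => ?_⟩
  rw [Walk.mem_support_append_iff] at hs
  exact hs.elim (hp s) (hq s)

theorem of_adj (h : G.Adj u v) (hu : u ∉ X) (hv : v ∉ X) : G.ReachableAvoiding X u v :=
  ⟨.cons h .nil, by simp [hu, hv]⟩

theorem mono {Y : Set V} (h : G.ReachableAvoiding X u v) (hY : Y ⊆ X) :
    G.ReachableAvoiding Y u v := by
  obtain ⟨p, hp⟩ := h
  exact ⟨p, fun s hs hsY => hp s hs (hY hsY)⟩

theorem right_notMem (h : G.ReachableAvoiding X u v) : v ∉ X := by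
  obtain ⟨p, hp⟩ := h
  exact hp _ p.end_mem_support

theorem map {W : Type*} {H : SimpleGraph W} {Y : Set W} (f : G →g H)
    (hf : ∀ s, f s ∈ Y → s ∈ X) (h : G.ReachableAvoiding X u v) :
    H.ReachableAvoiding Y (f u) (f v) := by
  obtain ⟨p, hp⟩ := h
  refine ⟨p.map f, fun s hs hsY => ?_⟩
  rw [Walk.support_map, List.mem_map] at hs
  obtain ⟨t, ht, rfl⟩ := hs
  exact hp t ht (hf t hsY)

end SimpleGraph.ReachableAvoiding

/-! ### Menger's theorem for vertex sets -/

namespace SimpleGraph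

variable {V : Type*}

/-- The set `X` meets every walk from `A` to `B`. -/
def Separates (G : SimpleGraph V) (A B X : Set V) : Prop :=
  ∀ a ∈ A, ∀ b ∈ B, ¬ G.ReachableAvoiding X a b

theorem Separates.symm {G : SimpleGraph V} {A B X : Set V} (h : G.Separates A B X) :
    G.Separates B A X := fun b hb a ha hr => h a ha b hb hr.symm

/-- If `S` separates `A` from `B` once the edge `xy` is deleted and `y` is not on the `A`-side, then
everything that separates `A` from `S ∪ {x}` without `xy` separates `A` from `B`. -/
theorem Separates.of_separates_insert {G G' : SimpleGraph V} {A B S X : Set V} {x y : V}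
    (hG : ∀ u v, G.Adj u v → G'.Adj u v ∨ (u = x ∧ v = y) ∨ (u = y ∧ v = x))
    (hS : G'.Separates A B S) (hy : ∀ a ∈ A, ¬ G'.ReachableAvoiding S a y)
    (hX : G'.Separates A (insert x S) X) : G.Separates A B X := by
  rintro a ha b hb ⟨w, hw⟩
  -- A walk from `a` to `b` must leave `T`. It does so either into `insert x S`, which `X` was to
  -- prevent, or along the restored edge, whose ends are excluded on this side.
  let T : Set V := {v | G'.ReachableAvoiding (X ∪ insert x S) a v}
  have hSub : S ⊆ X ∪ insert x S := fun s hs => Or.inr (Or.inr hs)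
  have haX : a ∉ X := hw a w.start_mem_support
  have haT : a ∈ T := by
    refine ReachableAvoiding.refl ?_
    rintro (h | h)
    · exact haX h
    · exact hX a ha a h (.refl haX)
  have hbT : b ∉ T := fun h => hS a ha b hb (h.mono hSub)
  obtain ⟨d, hd, hu, hv⟩ := w.exists_boundary_dart T haT hbT
  have huT : d.fst ∉ X ∪ insert x S := ReachableAvoiding.right_notMem hu
  have hvX : d.snd ∉ X := hw _ (w.dart_snd_mem_support_of_mem_darts hd)
  by_cases hvP : d.snd ∈ insert x S
  · rcases hG _ _ d.adj with h | ⟨h, -⟩ | ⟨h, -⟩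
    · exact hX a ha _ hvP ((hu.mono Set.subset_union_left).trans
        (.of_adj h (fun h' => huT (Or.inl h')) hvX))
    · exact huT (Or.inr (Or.inl h))
    · exact hy a ha (h ▸ hu.mono hSub)
  · rcases hG _ _ d.adj with h | ⟨h, -⟩ | ⟨-, h⟩
    · exact hv (ReachableAvoiding.trans hu (.of_adj h huT (by rintro (h | h) <;> contradiction)))
    · exact huT (Or.inr (Or.inl h))
    · exact hvP (Or.inl h)

/-- There are `k` pairwise disjoint paths from `A` to `B`. -/
def HasDisjointPaths (G : SimpleGraph V) (A B : Set V) (k : ℕ) : Prop :=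
  ∃ (a b : Fin k → V) (p : ∀ i, G.Walk (a i) (b i)), (∀ i, a i ∈ A) ∧ (∀ i, b i ∈ B) ∧
    (∀ i, (p i).IsPath) ∧ ∀ i j v, v ∈ (p i).support → v ∈ (p j).support → i = j

theorem HasDisjointPaths.mono {G G' : SimpleGraph V} {A B : Set V} {k : ℕ}
    (h : G'.HasDisjointPaths A B k) (hle : G' ≤ G) : G.HasDisjointPaths A B k := by
  obtain ⟨a, b, p, ha, hb, hp, hd⟩ := h
  exact ⟨a, b, fun i => (p i).mapLe hle, ha, hb, fun i => (Walk.isPath_mapLe hle).2 (hp i),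
    by simpa using hd⟩

/-- The walk from `v` to the start of a path, for `v` other than the end. -/
theorem Walk.IsPath.reachableAvoiding {G : SimpleGraph V} {a b v : V} {p : G.Walk a b} {S : Set V}
    (hp : p.IsPath) (hS : ∀ s ∈ p.support, s ∈ S → s = b) (hv : v ∈ p.support) (hvb : v ≠ b) :
    G.ReachableAvoiding S a v := by
  classical
  refine ⟨p.takeUntil v hv, fun s hs hsS => ?_⟩
  have := hS s (p.support_takeUntil_subset_support hv hs) hsS
  subst this
  exact Walk.endpoint_notMem_support_takeUntil hp hv hvb.symm hs

/-- The gluing step of Menger's theorem. The paths from `A` use up all of `S ∪ {x}` as ends, those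
from `B` all of `S ∪ {y}`. Apart from their ends they lie on different sides of `S`, so they meet
only at common ends in `S`; there they are concatenated, and the two ends `x`, `y` are joined by the
restored edge. -/
theorem HasDisjointPaths.join [Fintype V] {G G' : SimpleGraph V} {A B : Set V} {S : Finset V}
    {x y : V} {k : ℕ} (hle : G' ≤ G) (hxy : G.Adj x y) (hxS : x ∉ S) (hyS : y ∉ S)
    (hk : S.card + 1 = k) (hS : G'.Separates A B S)
    (hx : ∀ b ∈ B, ¬ G'.ReachableAvoiding S b x)
    (hy : ∀ a ∈ A, ¬ G'.ReachableAvoiding S a y)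
    (hP : G'.HasDisjointPaths A (insert x (S : Set V)) k)
    (hQ : G'.HasDisjointPaths B (insert y (S : Set V)) k) : G.HasDisjointPaths A B k := by
  classical
  obtain ⟨a, e, p, ha, he, hp, hpd⟩ := hP
  obtain ⟨b, f, q, hb, hf, hq, hqd⟩ := hQ
  have hxy' : x ≠ y := hxy.ne
  have surj : ∀ (z : V) (g : Fin k → V), z ∉ S → (∀ i, g i ∈ insert z (S : Set V)) →
      Function.Injective g → ∀ s ∈ insert z (S : Set V), ∃ i, g i = s := by
    intro z g hz hg hgi s hs
    have himg : Finset.univ.image g = insert z S := by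
      apply Finset.eq_of_subset_of_card_le
      · intro t ht
        obtain ⟨i, -, rfl⟩ := Finset.mem_image.1 ht
        simpa using hg i
      · rw [Finset.card_image_of_injective _ hgi, Finset.card_insert_of_notMem hz]
        simp [hk]
    have : s ∈ Finset.univ.image g := by rw [himg]; simpa using hs
    simpa using this
  have einj : Function.Injective e := fun i j h =>
    hpd i j (e i) (p i).end_mem_support (by rw [h]; exact (p j).end_mem_support)
  have finj : Function.Injective f := fun i j h =>
    hqd i j (f i) (q i).end_mem_support (by rw [h]; exact (q j).end_mem_support)
  have esurj := surj x e hxS he einj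
  have fsurj := surj y f hyS hf finj
  have hpP : ∀ i, ∀ s ∈ (p i).support, s ∈ insert x (S : Set V) → s = e i := by
    intro i s hs hsP
    obtain ⟨j, rfl⟩ := esurj s hsP
    rw [hpd i j _ hs (p j).end_mem_support]
  have hqQ : ∀ i, ∀ s ∈ (q i).support, s ∈ insert y (S : Set V) → s = f i := by
    intro i s hs hsP
    obtain ⟨j, rfl⟩ := fsurj s hsP
    rw [hqd i j _ hs (q j).end_mem_support]
  have hra : ∀ i, ∀ v ∈ (p i).support, v ≠ e i → G'.ReachableAvoiding S (a i) v :=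
    fun i v hv hve => (hp i).reachableAvoiding (fun s hs hsS => hpP i s hs (Or.inr hsS)) hv hve
  have hrb : ∀ i, ∀ v ∈ (q i).support, v ≠ f i → G'.ReachableAvoiding S (b i) v :=
    fun i v hv hve => (hq i).reachableAvoiding (fun s hs hsS => hqQ i s hs (Or.inr hsS)) hv hve
  have cross : ∀ i l v, v ∈ (p i).support → v ∈ (q l).support → v ∈ S ∧ v = e i ∧ v = f l := by
    intro i l v hvp hvq
    have key : v = e i := by
      by_contra hve
      have h1 := hra i v hvp hve
      by_cases hvf : v = f l
      · rcases hf l with h | h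
        · exact hy _ (ha i) (h ▸ hvf ▸ h1)
        · exact hve (hpP i v hvp (Or.inr (hvf ▸ h)))
      · exact hS _ (ha i) _ (hb l) (h1.trans (hrb l v hvq hvf).symm)
    have hvS : v ∈ S := by
      rcases he i with h | h
      · exfalso
        have hvx : v = x := key.trans h
        refine hx _ (hb l) (hvx ▸ hrb l v hvq ?_)
        rintro hvf
        have := hf l
        rw [← hvf, hvx] at this
        rcases this with h | h
        · exact hxy' h
        · exact hxS h
      · exact key ▸ h
    exact ⟨hvS, key, hqQ l v hvq (Or.inr hvS)⟩
  -- The path that ends in `x` continues from `y`; one that ends in `S` continues from the same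
  -- vertex.
  let φ : V → V := fun s => if s = x then y else s
  have hφ : ∀ i, ∃ l, f l = φ (e i) := by
    intro i
    apply fsurj
    by_cases h : e i = x
    · simp [φ, h]
    · simp only [φ, h, if_false]
      exact Or.inr ((he i).resolve_left h)
  choose j hj using hφ
  have jinj : Function.Injective j := by
    intro i i' h
    have h1 : φ (e i) = φ (e i') := by rw [← hj, ← hj, h]
    apply einj
    have h2 := he i
    have h3 := he i'
    simp only [φ] at h1
    split_ifs at h1 with h4 h5 h5
    · rw [h4, h5]
    · exact absurd (h1 ▸ h3.resolve_left h5) hyS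
    · exact absurd (h1 ▸ h2.resolve_left h4) hyS
    · exact h1
  have hw : ∀ i, ∃ w : G.Walk (a i) (b (j i)), w.IsPath ∧
      ∀ v ∈ w.support, v ∈ (p i).support ∨ v ∈ (q (j i)).support := by
    intro i
    suffices h : ∃ w : G.Walk (a i) (b (j i)),
        ∀ v ∈ w.support, v ∈ (p i).support ∨ v ∈ (q (j i)).support by
      obtain ⟨w, hw⟩ := h
      exact ⟨w.bypass, w.bypass_isPath, fun v hv => hw v (w.support_bypass_subset_support hv)⟩
    by_cases h : e i = x
    · have h' : G.Adj (e i) (f (j i)) := by rw [hj, h]; simpa [φ] using hxy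
      refine ⟨((p i).mapLe hle).append (.cons h' ((q (j i)).reverse.mapLe hle)), fun v hv => ?_⟩
      simp only [Walk.mem_support_append_iff, Walk.support_cons, List.mem_cons,
        Walk.support_mapLe_eq_support, Walk.support_reverse, List.mem_reverse] at hv
      rcases hv with hv | rfl | hv
      · exact Or.inl hv
      · exact Or.inl (p i).end_mem_support
      · exact Or.inr hv
    · have h' : f (j i) = e i := by rw [hj]; simp [φ, h]
      refine ⟨((p i).mapLe hle).append (((q (j i)).reverse.mapLe hle).copy h' rfl), fun v hv => ?_⟩
      simpa [Walk.mem_support_append_iff] using hv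
  choose w hwp hws using hw
  refine ⟨a, fun i => b (j i), w, ha, fun i => hb _, hwp, fun i i' v hv hv' => ?_⟩
  have cross' : ∀ i i', v ∈ (p i).support → v ∈ (q (j i')).support → i = i' := by
    intro i i' h1 h2
    obtain ⟨hvS, h3, h4⟩ := cross i (j i') v h1 h2
    have hne : v ≠ x := fun h => hxS (h ▸ hvS)
    have hφv : φ (e i) = v := by simp [φ, ← h3, hne]
    exact jinj (finj (by rw [hj i, hφv, h4]))
  rcases hws i v hv with h | h <;> rcases hws i' v hv' with h' | h'
  · exact hpd i i' v h h'
  · exact cross' i i' h h'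
  · exact (cross' i' i h' h).symm
  · exact jinj (hqd _ _ v h h')

/-- **Menger's theorem**, for sets of vertices: if no set of fewer than `k` vertices separates `A`
from `B`, then there are `k` disjoint paths from `A` to `B`. -/
theorem menger [Fintype V] (G : SimpleGraph V) (A B : Set V) (k : ℕ)
    (h : ∀ X : Finset V, G.Separates A B X → k ≤ X.card) : G.HasDisjointPaths A B k := by
  classical
  induction G using WellFoundedLT.induction generalizing A B with
  | ind G ih =>
  by_cases hE : ∃ x y, G.Adj x y
  · obtain ⟨x₀, y₀, hxy₀⟩ := hE
    let G' := G.deleteEdges {s(x₀, y₀)}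
    have hle : G' ≤ G := G.deleteEdges_le _
    have hG₀ : ∀ u v, G.Adj u v → ¬ G'.Adj u v → s(u, v) = s(x₀, y₀) := by
      intro u v h h'
      by_contra hne
      exact h' (by simpa [G', h] using hne)
    have hlt : G' < G := by
      refine lt_of_le_of_ne hle fun h => ?_
      have : G'.Adj x₀ y₀ := h ▸ hxy₀
      simp [G'] at this
    by_cases h' : ∀ X : Finset V, G'.Separates A B X → k ≤ X.card
    · exact (ih G' hlt A B h').mono hle
    · push Not at h'
      obtain ⟨S, hS, hSk⟩ := h'
      -- `S` is too small to separate in `G`, so some walk leaves the `A`-side of `G' - S` while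
      -- avoiding `S`. The edge where it leaves is the deleted one, now oriented with `x` on the
      -- `A`-side.
      have hnS : ¬ G.Separates A B S := fun hs => absurd (h S hs) (by omega)
      simp only [Separates, not_forall, not_not] at hnS
      obtain ⟨a, ha, b, hb, w, hw⟩ := hnS
      let T : Set V := {v | ∃ a ∈ A, G'.ReachableAvoiding S a v}
      have haT : a ∈ T := ⟨a, ha, .refl (hw a w.start_mem_support)⟩
      have hbT : b ∉ T := fun ⟨a', ha', hr⟩ => hS a' ha' b hb hr
      obtain ⟨d, hd, hu, hv⟩ := w.exists_boundary_dart T haT hbT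
      obtain ⟨⟨x, y⟩, hxy⟩ := d
      simp only at hu hv
      have hxS : x ∉ (S : Set V) := by
        obtain ⟨_, _, hr⟩ := hu
        exact hr.right_notMem
      have hyS : y ∉ (S : Set V) := hw y (w.dart_snd_mem_support_of_mem_darts hd)
      have hnadj : ¬ G'.Adj x y := by
        intro hadj
        obtain ⟨a', ha', hr⟩ := hu
        exact hv ⟨a', ha', hr.trans (.of_adj hadj hxS hyS)⟩
      have hG : ∀ u v, G.Adj u v → G'.Adj u v ∨ (u = x ∧ v = y) ∨ (u = y ∧ v = x) := by
        intro u v huv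
        by_cases hc : G'.Adj u v
        · exact Or.inl hc
        · have := (hG₀ u v huv hc).trans (hG₀ x y hxy hnadj).symm
          exact Or.inr (by simpa using this)
      have hy : ∀ a ∈ A, ¬ G'.ReachableAvoiding S a y := fun a' ha' hr => hv ⟨a', ha', hr⟩
      have hx : ∀ b ∈ B, ¬ G'.ReachableAvoiding S b x := by
        intro b' hb' hr
        obtain ⟨a', ha', hr'⟩ := hu
        exact hS a' ha' b' hb' (hr'.trans hr.symm)
      have sepP : ∀ X : Finset V, G'.Separates A (insert x (S : Set V)) X → k ≤ X.card :=
        fun X hX => h X (Separates.of_separates_insert hG hS hy hX)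
      have sepQ : ∀ X : Finset V, G'.Separates B (insert y (S : Set V)) X → k ≤ X.card :=
        fun X hX => h X (Separates.of_separates_insert (x := y) (y := x)
          (fun u v huv => (hG u v huv).imp_right Or.symm) hS.symm hx hX).symm
      -- `insert x S` separates `A` from itself, so it has at least `k` elements, while `S` has
      -- fewer.
      have hk : S.card + 1 = k := by
        have := sepP (insert x S) (by
          intro a _ s hs hr
          exact hr.right_notMem (by simpa using hs))
        rw [Finset.card_insert_of_notMem (by simpa using hxS)] at this
        omega
      exact HasDisjointPaths.join hle hxy (by simpa using hxS) (by simpa using hyS) hk hS hx hy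
        (ih G' hlt _ _ sepP) (ih G' hlt _ _ sepQ)
  · push Not at hE
    -- Without edges, `A ∩ B` is a separator, and its vertices are trivial paths.
    let X : Finset V := Finset.univ.filter fun v => v ∈ A ∧ v ∈ B
    have hX : k ≤ X.card := by
      apply h
      rintro a ha b hb ⟨w, hw⟩
      cases w with
      | nil => exact hw a (by simp) (by simp [X, ha, hb])
      | cons hadj _ => exact hE _ _ hadj
    obtain ⟨Y, hYX, hY⟩ := Finset.exists_subset_card_eq hX
    let e := (Y.equivFinOfCardEq hY).symm
    have hmem : ∀ i, (e i : V) ∈ A ∧ (e i : V) ∈ B := fun i => by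
      simpa [X] using hYX (e i).2
    refine ⟨fun i => e i, fun i => e i, fun i => .nil, fun i => (hmem i).1, fun i => (hmem i).2,
      fun i => .nil, fun i j v hv hv' => ?_⟩
    simp only [Walk.support_nil, List.mem_singleton] at hv hv'
    exact e.injective (Subtype.ext (hv.symm.trans hv'))

end SimpleGraph

/-! ### Fans and packings of connected subgraphs -/

namespace SimpleGraph

variable {V : Type*}

/-- Removing fewer than `n` vertices from `G` leaves the other vertices connected. -/
def VertexConnected (G : SimpleGraph V) (n : ℕ) : Prop :=
  ∀ X : Finset V, X.card < n → ∀ u v, u ∉ X → v ∉ X → G.ReachableAvoiding X u v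

/-- The subgraph induced on a pair of vertices. -/
abbrev pairSubgraph (G : SimpleGraph V) (u v : V) : G.Subgraph :=
  (⊤ : G.Subgraph).induce {u, v}

theorem Subgraph.Connected.sup_of_mem {G : SimpleGraph V} {H K : G.Subgraph} (hH : H.Connected)
    (hK : K.Connected) {v : V} (hv : v ∈ H.verts) (hv' : v ∈ K.verts) : (H ⊔ K).Connected :=
  Subgraph.connected_sup hH.preconnected hK.preconnected ⟨v, hv, hv'⟩

/-- The **fan lemma**, for a root outside of the set of targets. -/
theorem VertexConnected.exists_fan_of_notMem [Fintype V] {G : SimpleGraph V} {n : ℕ}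
    (hG : G.VertexConnected n) {x : V} {U : Finset V} (hU : U.card ≤ n) (hxU : x ∉ U) :
    ∃ R : V → G.Subgraph,
      (∀ u ∈ U, (R u).Connected ∧ x ∈ (R u).verts ∧ u ∈ (R u).verts) ∧
      ∀ u ∈ U, ∀ v ∈ U, u ≠ v → (R u).verts ∩ (R v).verts ⊆ {x} := by
  classical
  have sep : ∀ X : Finset V, G.Separates {v | G.Adj x v} U X → U.card ≤ X.card := by
    intro X hX
    by_contra! hlt
    obtain ⟨u, hu, huX⟩ := Finset.exists_mem_notMem_of_card_lt_card hlt
    have hux : u ≠ x := fun h => hxU (h ▸ hu)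
    -- `X` may contain `x`, so only `X.erase x` is avoided. The path without its first vertex `x`
    -- starts at a neighbour and never returns to `x`, hence avoids all of `X`.
    obtain ⟨w, hw⟩ := hG (X.erase x) ((Finset.card_erase_le).trans_lt (by omega)) x u (by simp)
      (by simp [huX])
    have hw' : ∀ s ∈ w.bypass.support, s ∉ ((X.erase x : Finset V) : Set V) :=
      fun s hs => hw s (w.support_bypass_subset_support hs)
    have hp := w.bypass_isPath
    generalize w.bypass = q at hw' hp
    cases q with
    | nil => exact hux rfl
    | cons hadj q =>
      rw [Walk.cons_isPath_iff] at hp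
      refine hX _ hadj u hu ⟨q, fun s hs hsX => hw' s (by simp [hs]) ?_⟩
      have : s ≠ x := fun h => hp.2 (h ▸ hs)
      simpa [this] using hsX
  obtain ⟨a, b, p, ha, hb, -, hd⟩ := G.menger _ _ _ sep
  have binj : Function.Injective b := fun i j h =>
    hd i j (b i) (p i).end_mem_support (by rw [h]; exact (p j).end_mem_support)
  have bsurj : ∀ u ∈ U, ∃ i, b i = u := by
    have himg : Finset.univ.image b = U := by
      apply Finset.eq_of_subset_of_card_le
      · intro t ht
        obtain ⟨i, -, rfl⟩ := Finset.mem_image.1 ht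
        exact hb i
      · rw [Finset.card_image_of_injective _ binj]
        simp
    intro u hu
    rw [← himg] at hu
    simpa using hu
  have hR : ∀ u, ∃ H : G.Subgraph, u ∈ U → ∃ i, b i = u ∧ H.Connected ∧ x ∈ H.verts ∧
      u ∈ H.verts ∧ ∀ v ∈ H.verts, v = x ∨ v ∈ (p i).support := by
    intro u
    by_cases hu : u ∈ U
    · obtain ⟨i, rfl⟩ := bsurj u hu
      refine ⟨G.pairSubgraph x (a i) ⊔ (p i).toSubgraph, fun _ => ⟨i, rfl, ?_, ?_, ?_, ?_⟩⟩
      · exact (Subgraph.top_induce_pair_connected_of_adj (ha i)).sup_of_mem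
          (p i).toSubgraph_connected (v := a i) (by simp) (by simp)
      · simp
      · simp
      · intro v hv
        simp only [Subgraph.verts_sup, Subgraph.induce_verts, Set.mem_union, Set.mem_insert_iff,
          Set.mem_singleton_iff, Walk.mem_verts_toSubgraph] at hv
        rcases hv with (h | rfl) | h
        · exact Or.inl h
        · exact Or.inr (p i).start_mem_support
        · exact Or.inr h
    · exact ⟨⊥, fun h => absurd h hu⟩
  choose R hR using hR
  refine ⟨R, fun u hu => ?_, fun u hu v hv huv s hs => ?_⟩
  · obtain ⟨-, -, h1, h2, h3, -⟩ := hR u hu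
    exact ⟨h1, h2, h3⟩
  · obtain ⟨i, rfl, -, -, -, h1⟩ := hR u hu
    obtain ⟨j, rfl, -, -, -, h2⟩ := hR v hv
    rcases h1 s hs.1 with h | h
    · exact h
    rcases h2 s hs.2 with h' | h'
    · exact h'
    · exact absurd (congrArg b (hd i j s h h')) huv

/-- The **fan lemma**: in a graph that stays connected after removing fewer than `n` vertices, a
vertex `x` can be joined to `n` distinct targets by connected subgraphs that meet only in `x`. -/
theorem VertexConnected.exists_fan [Fintype V] {G : SimpleGraph V} {n : ℕ}
    (hG : G.VertexConnected n) (x : V) {U : Finset V} (hU : U.card ≤ n) :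
    ∃ R : V → G.Subgraph,
      (∀ u ∈ U, (R u).Connected ∧ x ∈ (R u).verts ∧ u ∈ (R u).verts) ∧
      ∀ u ∈ U, ∀ v ∈ U, u ≠ v → (R u).verts ∩ (R v).verts ⊆ {x} := by
  classical
  obtain ⟨R, hR, hd⟩ := hG.exists_fan_of_notMem (x := x) (U := U.erase x)
    ((Finset.card_erase_le).trans hU) (by simp)
  refine ⟨fun u => if u = x then G.singletonSubgraph x else R u, fun u hu => ?_,
    fun u hu v hv huv => ?_⟩
  · by_cases h : u = x
    · subst h
      simp [Subgraph.singletonSubgraph_connected]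
    · simpa [h] using hR u (by simp [h, hu])
  · by_cases h : u = x
    · simp [h]
    · by_cases h' : v = x
      · simp [h']
      · simpa [h, h'] using hd u (by simp [h, hu]) v (by simp [h', hv]) huv

/-- The subgraphs `T i` are connected, contain `S`, meet pairwise in exactly `S`, and have pairwise
no common edge. -/
structure IsConnectedPacking (G : SimpleGraph V) (S : Set V) {ι : Type*} (T : ι → G.Subgraph) :
    Prop where
  connected : ∀ i, (T i).Connected
  subset_verts : ∀ i, S ⊆ (T i).verts
  verts_inter : ∀ i j, i ≠ j → (T i).verts ∩ (T j).verts ⊆ S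
  not_adj : ∀ i j, i ≠ j → ∀ u v, (T i).Adj u v → ¬ (T j).Adj u v

/-- Subgraphs with at most one common vertex have no common edge. -/
theorem Subgraph.not_adj_of_inter_subset {G : SimpleGraph V} {H K : G.Subgraph} {s u v : V}
    (h : H.verts ∩ K.verts ⊆ {s}) (hH : H.Adj u v) : ¬ K.Adj u v := fun hK =>
  hH.ne ((h ⟨hH.fst_mem, hK.fst_mem⟩ : u = s).trans (h ⟨hH.snd_mem, hK.snd_mem⟩ : v = s).symm)

/-- `n` connected subgraphs joining `x` and `y`, one through each neighbor of `x`. -/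
theorem VertexConnected.exists_packing_pair [Fintype V] {G : SimpleGraph V} {n : ℕ}
    (hG : G.VertexConnected n) {x y : V} (hxy : x ≠ y) {N : Finset V}
    (hN : ∀ w, w ∈ N ↔ G.Adj x w) (hcard : N.card ≤ n) :
    ∃ P : N → G.Subgraph, G.IsConnectedPacking {x, y} P ∧ ∀ w, (w : V) ∈ (P w).verts := by
  classical
  have hxN : x ∉ N := fun h => G.loopless.irrefl x ((hN x).1 h)
  obtain ⟨R, hR, hd, hRadj⟩ : ∃ R : V → G.Subgraph,
      (∀ w ∈ N, w ≠ y → (R w).Connected ∧ y ∈ (R w).verts ∧ w ∈ (R w).verts) ∧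
      (∀ w ∈ N, w ≠ y → ∀ w' ∈ N, w' ≠ y → w ≠ w' → (R w).verts ∩ (R w').verts ⊆ {y}) ∧
      ∀ w ∈ N, w ≠ y → ¬ (R w).Adj x y := by
    by_cases hadj : G.Adj x y
    · have hyN : y ∈ N := (hN y).2 hadj
      -- Exchanging the target `y` for `x` keeps the number of targets and forces the other members
      -- of the fan to avoid `x`. The edge `xy` is thereby reserved for the member through the
      -- neighbour `y`.
      obtain ⟨R, hR, hd⟩ := hG.exists_fan y (U := insert x (N.erase y)) (by
        rw [Finset.card_insert_of_notMem (by simp [hxN]), Finset.card_erase_of_mem hyN]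
        have := Finset.card_pos.2 ⟨y, hyN⟩
        omega)
      have hmem : ∀ w ∈ N, w ≠ y → w ∈ insert x (N.erase y) := fun w hw h => by simp [hw, h]
      refine ⟨R, fun w hw h => hR w (hmem w hw h), fun w hw h w' hw' h' =>
        hd w (hmem w hw h) w' (hmem w' hw' h'), fun w hw h hA => hxy ?_⟩
      exact hd w (hmem w hw h) x (by simp) (fun h' => hxN (h' ▸ hw))
        ⟨hA.fst_mem, (hR x (by simp)).2.2⟩
    · obtain ⟨R, hR, hd⟩ := hG.exists_fan y hcard
      exact ⟨R, fun w hw _ => hR w hw, fun w hw _ w' hw' _ => hd w hw w' hw',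
        fun w _ _ h => hadj h.adj_sub⟩
  let P : N → G.Subgraph := fun w =>
    if (w : V) = y then G.pairSubgraph x y else R w ⊔ G.pairSubgraph x w
  have hPy : ∀ w : N, (w : V) = y → P w = G.pairSubgraph x y := fun w h => by simp [P, h]
  have hPn : ∀ w : N, (w : V) ≠ y → P w = R w ⊔ G.pairSubgraph x w := fun w h => by simp [P, h]
  have hPadj : ∀ w : N, (w : V) ≠ y → ¬ (P w).Adj x y := by
    intro w h hA
    rw [hPn w h, Subgraph.sup_adj] at hA
    rcases hA with hA | hA
    · exact hRadj w w.2 h hA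
    · rcases hA.snd_mem with h' | h'
      · exact hxy h'.symm
      · exact h h'.symm
  have hinter : ∀ i j : N, i ≠ j → (P i).verts ∩ (P j).verts ⊆ {x, y} := by
    intro i j hij v hv
    have hij' : (i : V) ≠ j := fun h => hij (Subtype.ext h)
    by_cases hi : (i : V) = y
    · rw [hPy i hi] at hv
      exact hv.1
    by_cases hj : (j : V) = y
    · rw [hPy j hj] at hv
      exact hv.2
    rw [hPn i hi, hPn j hj] at hv
    have hmem : ∀ w : N, (w : V) ≠ y → v ∈ (R w ⊔ G.pairSubgraph x w).verts →
        v = x ∨ v ∈ (R w).verts := by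
      rintro w h (h' | h' | h')
      · exact Or.inr h'
      · exact Or.inl h'
      · exact Or.inr (h' ▸ (hR w w.2 h).2.2)
    rcases hmem i hi hv.1 with h | h
    · exact Or.inl h
    rcases hmem j hj hv.2 with h' | h'
    · exact Or.inl h'
    exact Or.inr (hd i i.2 hi j j.2 hj hij' ⟨h, h'⟩)
  refine ⟨P, ⟨fun w => ?_, fun w => ?_, hinter, fun i j hij u v hu hv => ?_⟩, fun w => ?_⟩
  · by_cases h : (w : V) = y
    · rw [hPy w h]
      exact Subgraph.top_induce_pair_connected_of_adj ((hN y).1 (h ▸ w.2))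
    · rw [hPn w h]
      exact (hR w w.2 h).1.sup_of_mem
        (Subgraph.top_induce_pair_connected_of_adj ((hN w).1 w.2)) (hR w w.2 h).2.2 (by simp)
  · by_cases h : (w : V) = y
    · rw [hPy w h]
      exact subset_rfl
    · rw [hPn w h]
      rintro v (rfl | rfl)
      · simp
      · exact Or.inl (hR w w.2 h).2.1
  · have hxy' : (P i).Adj x y ∧ (P j).Adj x y := by
      have h1 := hinter i j hij ⟨hu.fst_mem, hv.fst_mem⟩
      have h2 := hinter i j hij ⟨hu.snd_mem, hv.snd_mem⟩
      have h3 := hu.ne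
      rcases h1 with rfl | rfl <;> rcases h2 with rfl | rfl
      · exact absurd rfl h3
      · exact ⟨hu, hv⟩
      · exact ⟨hu.symm, hv.symm⟩
      · exact absurd rfl h3
    by_cases hi : (i : V) = y
    · by_cases hj : (j : V) = y
      · exact hij (Subtype.ext (hi.trans hj.symm))
      · exact hPadj j hj hxy'.2
    · exact hPadj i hi hxy'.1
  · by_cases h : (w : V) = y
    · rw [hPy w h]
      simp [h]
    · rw [hPn w h]
      exact Or.inl (hR w w.2 h).2.2

theorem IsConnectedPacking.comp {G : SimpleGraph V} {S : Set V} {ι κ : Type*} {T : ι → G.Subgraph}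
    (h : G.IsConnectedPacking S T) {f : κ → ι} (hf : Function.Injective f) :
    G.IsConnectedPacking S (T ∘ f) where
  connected i := h.connected (f i)
  subset_verts i := h.subset_verts (f i)
  verts_inter _ _ hij := h.verts_inter _ _ (hf.ne hij)
  not_adj _ _ hij := h.not_adj _ _ (hf.ne hij)

/-- In an `n`-regular graph of connectivity `n`, there are `n` connected subgraphs that join `x` and
`y` and have distinct representatives other than a given vertex `a`. -/
theorem VertexConnected.exists_packing_pair_fin [Fintype V] {G : SimpleGraph V} {n : ℕ}
    (hG : G.VertexConnected n)
    (hreg : ∀ x, ∃ N : Finset V, N.card = n ∧ ∀ w, w ∈ N ↔ G.Adj x w)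
    {x y : V} (hxy : x ≠ y) (a : V) :
    ∃ (P : Fin n → G.Subgraph) (w : Fin n → V), G.IsConnectedPacking {x, y} P ∧
      Function.Injective w ∧ ∀ i, w i ∈ (P i).verts ∧ w i ≠ a := by
  classical
  have main : ∀ x y : V, x ≠ y → ¬ G.Adj x a →
      ∃ (P : Fin n → G.Subgraph) (w : Fin n → V), G.IsConnectedPacking {x, y} P ∧
        Function.Injective w ∧ ∀ i, w i ∈ (P i).verts ∧ w i ≠ a := by
    intro x y hxy ha
    obtain ⟨N, hcard, hN⟩ := hreg x
    obtain ⟨P, hP, hw⟩ := hG.exists_packing_pair hxy hN hcard.le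
    let e := (N.equivFinOfCardEq hcard).symm
    exact ⟨P ∘ e, fun i => e i, hP.comp e.injective, Subtype.val_injective.comp e.injective,
      fun i => ⟨hw _, fun h => ha (h ▸ (hN _).1 (e i).2)⟩⟩
  by_cases hxa : G.Adj x a
  · by_cases hya : G.Adj y a
    · obtain ⟨N, hcard, hN⟩ := hreg x
      obtain ⟨P, hP, hw⟩ := hG.exists_packing_pair hxy hN hcard.le
      let e := (N.equivFinOfCardEq hcard).symm
      have hne : ∀ i, (e i : V) ≠ x := fun i h => by
        have := (hN _).1 (e i).2
        rw [h] at this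
        exact G.loopless.irrefl x this
      -- Every member contains `x`, which is not its own neighbour, so `x` can stand in for `a` as a
      -- representative.
      refine ⟨P ∘ e, fun i => if (e i : V) = a then x else e i, hP.comp e.injective, ?_, ?_⟩
      · intro i j h
        apply e.injective
        apply Subtype.ext
        simp only at h
        split_ifs at h with h1 h2 h2
        · rw [h1, h2]
        · exact absurd h.symm (hne j)
        · exact absurd h (hne i)
        · exact h
      · intro i
        simp only
        split_ifs with h
        · exact ⟨hP.subset_verts _ (by simp), hxa.ne⟩
        · exact ⟨hw _, h⟩
    · rw [Set.pair_comm]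
      exact main y x hxy.symm hya
  · exact main x y hxy hxa

/-- The fan lemma for an indexed family of targets. -/
theorem VertexConnected.exists_packing_fan [Fintype V] {G : SimpleGraph V} {n : ℕ}
    (hG : G.VertexConnected n) (x : V) {u : Fin n → V} (hu : Function.Injective u) :
    ∃ R : Fin n → G.Subgraph, G.IsConnectedPacking {x} R ∧ ∀ i, u i ∈ (R i).verts := by
  classical
  obtain ⟨R, hR, hd⟩ := hG.exists_fan x (U := Finset.univ.image u)
    (Finset.card_image_le.trans (by simp))
  have hmem : ∀ i, u i ∈ Finset.univ.image u := fun i => by simp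
  have hd' : ∀ i j, i ≠ j → (R (u i)).verts ∩ (R (u j)).verts ⊆ {x} := fun i j hij =>
    hd _ (hmem i) _ (hmem j) (hu.ne hij)
  exact ⟨fun i => R (u i), ⟨fun i => (hR _ (hmem i)).1,
    fun i => Set.singleton_subset_iff.2 (hR _ (hmem i)).2.1, hd',
    fun i j hij u v => Subgraph.not_adj_of_inter_subset (hd' i j hij)⟩,
    fun i => (hR _ (hmem i)).2.2⟩

/-- Enlarging each member `T i` of a packing by a member `L i` of a packing within a set that `T i`
meets in a single vertex. -/
theorem IsConnectedPacking.sup {G : SimpleGraph V} {S S' A : Set V} {ι : Type*}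
    {T L : ι → G.Subgraph} {w : ι → V} (hT : G.IsConnectedPacking S T)
    (hL : G.IsConnectedPacking S' L) (hLA : ∀ i, (L i).verts ⊆ A)
    (hTA : ∀ i, (T i).verts ∩ A ⊆ {w i}) (hwT : ∀ i, w i ∈ (T i).verts)
    (hwL : ∀ i, w i ∈ (L i).verts) : G.IsConnectedPacking (S ∪ S') fun i => T i ⊔ L i := by
  have hTL : ∀ i j, (T i).verts ∩ (L j).verts ⊆ {w i} := fun i j v hv => hTA i ⟨hv.1, hLA j hv.2⟩
  have hTL' : ∀ i j, i ≠ j → (T i).verts ∩ (L j).verts ⊆ S' := fun i j hij v hv => by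
    have : v = w i := hTL i j hv
    subst this
    exact hL.verts_inter i j hij ⟨hwL i, hv.2⟩
  refine ⟨fun i => (hT.connected i).sup_of_mem (hL.connected i) (hwT i) (hwL i),
    fun i => Set.union_subset_union (hT.subset_verts i) (hL.subset_verts i), ?_, ?_⟩
  · rintro i j hij v ⟨h | h, h' | h'⟩
    · exact Or.inl (hT.verts_inter i j hij ⟨h, h'⟩)
    · exact Or.inr (hTL' i j hij ⟨h, h'⟩)
    · exact Or.inr (hTL' j i hij.symm ⟨h', h⟩)
    · exact Or.inr (hL.verts_inter i j hij ⟨h, h'⟩)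
  · intro i j hij u v h h'
    rw [Subgraph.sup_adj] at h h'
    rcases h with h | h <;> rcases h' with h' | h'
    · exact hT.not_adj i j hij u v h h'
    · exact Subgraph.not_adj_of_inter_subset (hTL i j) h h'
    · exact Subgraph.not_adj_of_inter_subset (hTL j i) h' h
    · exact hL.not_adj i j hij u v h h'

/-- Adding one more member to a packing. -/
theorem IsConnectedPacking.option {G : SimpleGraph V} {S : Set V} {ι : Type*} {T : ι → G.Subgraph}
    {H : G.Subgraph} (hT : G.IsConnectedPacking S T) (hH : H.Connected) (hS : S ⊆ H.verts)
    (hHT : ∀ i, H.verts ∩ (T i).verts ⊆ S) (hadj : ∀ i u v, H.Adj u v → ¬ (T i).Adj u v) :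
    G.IsConnectedPacking S fun o : Option ι => o.elim H T := by
  refine ⟨?_, ?_, ?_, ?_⟩
  · rintro (_ | i)
    exacts [hH, hT.connected i]
  · rintro (_ | i)
    exacts [hS, hT.subset_verts i]
  · rintro (_ | i) (_ | j) hij
    · exact absurd rfl hij
    · exact hHT j
    · rw [Set.inter_comm]
      exact hHT i
    · exact hT.verts_inter i j (fun h => hij (h ▸ rfl))
  · rintro (_ | i) (_ | j) hij u v
    · exact absurd rfl hij
    · exact hadj j u v
    · exact fun h h' => hadj i u v h' h
    · exact hT.not_adj i j (fun h => hij (h ▸ rfl)) u v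

theorem Subgraph.Connected.map_hom {W : Type*} {G : SimpleGraph V} {G' : SimpleGraph W}
    {H : G.Subgraph} (hH : H.Connected) (f : G →g G') : (H.map f).Connected := by
  rw [Subgraph.connected_iff_forall_exists_walk_subgraph] at hH ⊢
  refine ⟨hH.1.image f, ?_⟩
  rintro _ _ ⟨u, hu, rfl⟩ ⟨v, hv, rfl⟩
  obtain ⟨p, hp⟩ := hH.2 hu hv
  exact ⟨p.map f, by rw [Walk.toSubgraph_map]; exact Subgraph.map_mono hp⟩

theorem IsConnectedPacking.map {W : Type*} {G : SimpleGraph V} {G' : SimpleGraph W} {S : Set V}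
    {ι : Type*} {T : ι → G.Subgraph} (hT : G.IsConnectedPacking S T) {f : G →g G'}
    (hf : Function.Injective f) : G'.IsConnectedPacking (f '' S) fun i => (T i).map f where
  connected i := (hT.connected i).map_hom f
  subset_verts i := Set.image_mono (hT.subset_verts i)
  verts_inter i j hij := by
    rintro _ ⟨⟨u, hu, rfl⟩, ⟨v, hv, h⟩⟩
    rw [hf h] at hv
    exact ⟨u, hT.verts_inter i j hij ⟨hu, hv⟩, rfl⟩
  not_adj i j hij := by
    rintro _ _ ⟨u, v, h, rfl, rfl⟩ ⟨u', v', h', hu, hv⟩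
    rw [hf hu, hf hv] at h'
    exact hT.not_adj i j hij u v h h'

/-- Every connected subgraph has a spanning tree. -/
theorem Subgraph.Connected.exists_isTree {G : SimpleGraph V} {H : G.Subgraph} (hH : H.Connected) :
    ∃ K ≤ H, K.verts = H.verts ∧ K.coe.IsTree := by
  obtain ⟨F, hF, hT⟩ := hH.coe.exists_isTree_le
  let K : G.Subgraph :=
    { verts := H.verts
      Adj := fun u v => ∃ (hu : u ∈ H.verts) (hv : v ∈ H.verts), F.Adj ⟨u, hu⟩ ⟨v, hv⟩
      adj_sub := fun ⟨_, _, h⟩ => (hF h : H.Adj _ _).adj_sub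
      edge_vert := fun ⟨h, _, _⟩ => h
      symm := ⟨fun _ _ ⟨hu, hv, h⟩ => ⟨hv, hu, h.symm⟩⟩ }
  have hK : K.coe = F := by
    ext ⟨u, hu⟩ ⟨v, hv⟩
    exact ⟨fun ⟨_, _, h⟩ => h, fun h => ⟨hu, hv, h⟩⟩
  exact ⟨K, ⟨subset_rfl, fun u v ⟨_, _, h⟩ => hF h⟩, rfl, hK ▸ hT⟩

/-- Spanning trees keep the vertex sets and only lose edges, so packings of connected subgraphs
suffice. -/
theorem IsConnectedPacking.le_treeConnectivity {G : SimpleGraph V} {S : Set V} {ι : Type*}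
    [Fintype ι] {T : ι → G.Subgraph} (hT : G.IsConnectedPacking S T) :
    (Fintype.card ι : ℕ∞) ≤ treeConnectivity G S := by
  choose K hK hv ht using fun i => (hT.connected i).exists_isTree
  let e := (Fintype.equivFin ι).symm
  refine le_iSup₂_of_le (Fintype.card ι) ⟨fun i => K (e i), ⟨fun i => ht _, fun i => ?_,
    fun i j hij => ?_, fun i j hij => ?_⟩⟩ le_rfl
  · rw [hv]
    exact hT.subset_verts _
  · rw [hv, hv]
    exact subset_antisymm (hT.verts_inter _ _ (e.injective.ne hij))
      (Set.subset_inter (hT.subset_verts _) (hT.subset_verts _))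
  · ext z
    induction z with
    | h u v =>
      simp only [Set.mem_inter_iff, Subgraph.mem_edgeSet, Set.mem_empty_iff_false, iff_false]
      rintro ⟨h, h'⟩
      exact hT.not_adj _ _ (e.injective.ne hij) u v ((hK _).2 h) ((hK _).2 h')

/-! ### Upper bound from two adjacent vertices -/

/-- Two adjacent vertices of degree at most `n + 1` admit at most `n` internally disjoint trees
that reach a third vertex. -/
theorem treeConnectivity_le_of_adj {G : SimpleGraph V} {S : Set V} {x y z : V} {n : ℕ}
    (hxy : G.Adj x y) (hx : x ∈ S) (hy : y ∈ S) (hz : z ∈ S) (hzx : z ≠ x) (hzy : z ≠ y)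
    {Nx Ny : Finset V} (hNx : ∀ w, G.Adj x w → w ∈ Nx) (hNy : ∀ w, G.Adj y w → w ∈ Ny)
    (hcx : Nx.card ≤ n + 1) (hcy : Ny.card ≤ n + 1) : treeConnectivity G S ≤ n := by
  classical
  refine iSup₂_le fun r ⟨T, hT⟩ => ?_
  rw [Nat.cast_le]
  by_contra! hr
  have hno : ∀ i j u v, (T i).Adj u v → (T j).Adj u v → i = j := by
    intro i j u v h h'
    by_contra hij
    have : s(u, v) ∈ (T i).edgeSet ∩ (T j).edgeSet := ⟨h, h'⟩
    rw [hT.edgeSet_inter i j hij] at this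
    exact this
  have hcon : ∀ i, (T i).Connected := fun i => ⟨(hT.isTree i).1⟩
  have hnb : ∀ i, ∀ u ∈ S, ∃ v, (T i).Adj u v := by
    intro i u hu
    have hnt : Nontrivial (T i).verts :=
      ⟨⟨x, hT.subset_verts i hx⟩, ⟨y, hT.subset_verts i hy⟩, fun h => hxy.ne (congrArg (·.1) h)⟩
    obtain ⟨v, hv⟩ := (hcon i).preconnected.exists_adj_of_nontrivial ⟨u, hT.subset_verts i hu⟩
    exact ⟨v, hv⟩
  -- More than `n` edge disjoint trees each use an edge at `u`, and at most `n + 1` edges are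
  -- available. So every edge at `u` is used, and each tree has exactly one of them.
  have key : ∀ u v, u ∈ S → G.Adj u v → ∀ N : Finset V, (∀ w, G.Adj u w → w ∈ N) →
      N.card ≤ n + 1 → ∃ i, (T i).Adj u v ∧ ∀ w, (T i).Adj u w → w = v := by
    intro u v hu huv N hN hc
    choose f hf using fun i => hnb i u hu
    have finj : Function.Injective f := fun i j h => hno i j u (f i) (hf i) (h ▸ hf j)
    have himg : Finset.univ.image f = N := by
      apply Finset.eq_of_subset_of_card_le
      · intro t ht
        obtain ⟨i, -, rfl⟩ := Finset.mem_image.1 ht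
        exact hN _ (hf i).adj_sub
      · rw [Finset.card_image_of_injective _ finj]
        simp
        omega
    have fsurj : ∀ w, G.Adj u w → ∃ i, f i = w := fun w hw => by
      have := hN w hw
      rw [← himg] at this
      simpa using this
    obtain ⟨i, rfl⟩ := fsurj v huv
    refine ⟨i, hf i, fun w hw => ?_⟩
    obtain ⟨j, rfl⟩ := fsurj w hw.adj_sub
    rw [hno i j u (f j) hw (hf j)]
  obtain ⟨i, hi, hi'⟩ := key x y hx hxy Nx hNx hcx
  obtain ⟨j, hj, hj'⟩ := key y x hy hxy.symm Ny hNy hcy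
  obtain rfl := hno i j x y hi hj.symm
  obtain ⟨p, hp⟩ := ((T i).connected_iff_forall_exists_walk_subgraph.1 (hcon i)).2
    (hT.subset_verts i hx) (hT.subset_verts i hz)
  -- The way to `z` leaves `{x, y}` by an edge other than `xy`, but this tree has no such edge at
  -- `x` or `y`.
  obtain ⟨d, hd, h1, h2⟩ := p.exists_boundary_dart {x, y} (by simp) (by simp [hzx, hzy])
  have hadj : (T i).Adj d.fst d.snd := hp.2 (by
    rw [Walk.adj_toSubgraph_iff_mem_edges]
    exact List.mem_map_of_mem hd)
  rcases h1 with h | h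
  · rw [h] at hadj
    exact h2 (Or.inr (hi' _ hadj))
  · rw [h] at hadj
    exact h2 (Or.inl (hj' _ hadj))

end SimpleGraph

/-! ### Connectivity and packings of the hypercube -/

open SimpleGraph

/-- A common edge would have two distinct ends in `S`, so edge disjointness is automatic here. -/
theorem SimpleGraph.IsConnectedPacking.of_subsingleton {V : Type*} {G : SimpleGraph V} {S : Set V}
    {ι : Type*} {T : ι → G.Subgraph} (hS : S.Subsingleton) (hT : ∀ i, (T i).Connected)
    (hST : ∀ i, S ⊆ (T i).verts) (hTT : ∀ i j, i ≠ j → (T i).verts ∩ (T j).verts ⊆ S) :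
    G.IsConnectedPacking S T := by
  refine ⟨hT, hST, hTT, fun i j hij u v h h' => h.ne ?_⟩
  exact hS (hTT i j hij ⟨h.fst_mem, h'.fst_mem⟩) (hTT i j hij ⟨h.snd_mem, h'.snd_mem⟩)

/-- The `n`-dimensional hypercube. -/
def hypercube (n : ℕ) : SimpleGraph (BinString n) where
  Adj p q := hammingDist p q = 1
  symm := ⟨fun _ _ h => by rwa [hammingDist_comm]⟩
  loopless := ⟨fun _ h => by simp at h⟩

namespace hypercube

variable {n : ℕ}

theorem adj_iff {p q : BinString n} : (hypercube n).Adj p q ↔ hammingDist p q = 1 := Iff.rfl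

theorem hammingDist_insertNth (e : Fin (n + 1)) (b c : Bool) (p q : BinString n) :
    hammingDist (e.insertNth b p : BinString (n + 1)) (e.insertNth c q) =
      (if b = c then 0 else 1) + hammingDist p q := by
  simp only [hammingDist, Finset.card_filter]
  rw [Fin.sum_univ_succAbove _ e]
  by_cases h : b = c <;> simp [h]

/-- The inclusion of a facet of the hypercube. -/
def facet (e : Fin (n + 1)) (b : Bool) : hypercube n →g hypercube (n + 1) where
  toFun p := e.insertNth b p
  map_rel' {p q} h := by
    rw [adj_iff] at h ⊢
    rw [hammingDist_insertNth]
    simp [h]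

theorem facet_injective (e : Fin (n + 1)) (b : Bool) : Function.Injective (facet e b) :=
  fun p q h => by
    have h' : (e.insertNth b p : BinString (n + 1)) = e.insertNth b q := h
    simpa using h'

theorem facet_apply_self (e : Fin (n + 1)) (b : Bool) (p : BinString n) : facet e b p e = b := by
  simp [facet]

theorem exists_eq_facet (e : Fin (n + 1)) (p : BinString (n + 1)) : ∃ q, p = facet e (p e) q :=
  ⟨e.removeNth p, (Fin.insertNth_self_removeNth e p).symm⟩

theorem facet_adj_facet (e : Fin (n + 1)) {b c : Bool} (h : b ≠ c) (p : BinString n) :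
    (hypercube (n + 1)).Adj (facet e b p) (facet e c p) := by
  rw [adj_iff]
  have := hammingDist_insertNth e b c p p
  rw [if_neg h, hammingDist_self] at this
  exact this

/-- Induction over two opposite facets. If both traces of `X` are small, both facets stay connected,
and `n < 2 ^ n` leaves a free edge between them. Otherwise one facet contains all of `X`, and every
remaining vertex can cross to the other, untouched one. The truncated `n - 1` makes `X` empty in
dimension 0. -/
theorem reachableAvoiding (n : ℕ) : ∀ X : Finset (BinString n), X.card ≤ n - 1 →
    ∀ u v, u ∉ X → v ∉ X → (hypercube n).ReachableAvoiding X u v := by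
  induction n with
  | zero =>
    intro X _ u v hu _
    rw [Subsingleton.elim v u]
    exact .refl (by simpa using hu)
  | succ n ih =>
    intro X hX
    let Y : Bool → Finset (BinString n) := fun b => Finset.univ.filter fun p => facet 0 b p ∈ X
    have hY : ∀ b p, p ∈ Y b ↔ facet 0 b p ∈ X := fun b p => by simp [Y]
    have hcard : (Y false).card + (Y true).card ≤ X.card := by
      rw [← Finset.card_image_of_injective (Y false) (facet_injective 0 false),
        ← Finset.card_image_of_injective (Y true) (facet_injective 0 true),
        ← Finset.card_union_of_disjoint]
      · apply Finset.card_le_card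
        intro p hp
        simp only [Finset.mem_union, Finset.mem_image, hY] at hp
        obtain ⟨q, hq, rfl⟩ | ⟨q, hq, rfl⟩ := hp <;> exact hq
      · rw [Finset.disjoint_left]
        intro p hp hp'
        obtain ⟨q, -, rfl⟩ := Finset.mem_image.1 hp
        obtain ⟨q', -, h⟩ := Finset.mem_image.1 hp'
        have := congrFun h 0
        rw [facet_apply_self, facet_apply_self] at this
        simp at this
    have half : ∀ b p q, (Y b).card ≤ n - 1 → facet 0 b p ∉ X → facet 0 b q ∉ X →
        (hypercube (n + 1)).ReachableAvoiding X (facet 0 b p) (facet 0 b q) := by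
      intro b p q hb hp hq
      exact (ih (Y b) hb p q (by simpa [hY] using hp) (by simpa [hY] using hq)).map (facet 0 b)
        fun s hs => by simpa [hY] using hs
    suffices h : ∃ r, ∀ u, u ∉ X → (hypercube (n + 1)).ReachableAvoiding X u r by
      obtain ⟨r, hr⟩ := h
      exact fun u v hu hv => (hr u hu).trans (hr v hv).symm
    have cross : ∀ b c p, b ≠ c → facet 0 b p ∉ X → facet 0 c p ∉ X →
        (hypercube (n + 1)).ReachableAvoiding X (facet 0 b p) (facet 0 c p) :=
      fun b c p hbc hb hc => .of_adj (facet_adj_facet 0 hbc p) hb hc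
    have one : ∀ b c, b ≠ c → (Y c).card = 0 → ∃ r, ∀ u, u ∉ X →
        (hypercube (n + 1)).ReachableAvoiding X u r := by
      intro b c hbc hc
      have hcX : ∀ p, facet 0 c p ∉ X := fun p hp => by
        have := (hY c p).2 hp
        rw [Finset.card_eq_zero.1 hc] at this
        simp at this
      refine ⟨facet 0 c fun _ => false, fun u hu => ?_⟩
      obtain ⟨q, hq⟩ := exists_eq_facet 0 u
      generalize u 0 = d at hq
      subst hq
      by_cases hd : d = c
      · subst hd
        exact half d _ _ (by omega) hu (hcX _)
      · exact (cross d c q hd hu (hcX _)).trans (half c _ _ (by omega) (hcX _) (hcX _))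
    by_cases h0 : (Y false).card ≤ n - 1
    · by_cases h1 : (Y true).card ≤ n - 1
      · obtain ⟨p, hp⟩ : ∃ p, p ∉ Y false ∪ Y true := by
          by_contra! h
          have h2 : Finset.univ ⊆ Y false ∪ Y true := fun p _ => h p
          have h3 := Finset.card_le_card h2
          have h4 := Finset.card_union_le (Y false) (Y true)
          have h5 : n < 2 ^ n := Nat.lt_two_pow_self
          simp only [Finset.card_univ, Fintype.card_pi, Fintype.card_bool, Finset.prod_const,
            Fintype.card_fin] at h3
          omega
        simp only [Finset.mem_union, hY, not_or] at hp
        refine ⟨facet 0 false p, fun u hu => ?_⟩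
        obtain ⟨q, hq⟩ := exists_eq_facet 0 u
        generalize u 0 = d at hq
        subst hq
        cases d with
        | false => exact half _ _ _ h0 hu hp.1
        | true => exact (half _ _ _ h1 hu hp.2).trans (cross _ _ _ (by simp) hp.2 hp.1)
      · exact one true false (by simp) (by omega)
    · exact one false true (by simp) (by omega)

theorem vertexConnected (n : ℕ) : (hypercube n).VertexConnected n :=
  fun X hX => reachableAvoiding n X (by omega)

theorem connected (n : ℕ) : (hypercube n).Connected where
  preconnected u v := by
    obtain ⟨w, -⟩ := reachableAvoiding n ∅ (by simp) u v (by simp) (by simp)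
    exact ⟨w⟩

/-- The neighbor of `p` in direction `i`. -/
def flip (p : BinString n) (i : Fin n) : BinString n := Function.update p i (!(p i))

theorem adj_iff_exists_flip {p q : BinString n} :
    (hypercube n).Adj p q ↔ ∃ i, flip p i = q := by
  rw [adj_iff, hammingDist, Finset.card_eq_one]
  constructor
  · rintro ⟨i, hi⟩
    refine ⟨i, funext fun j => ?_⟩
    have := Finset.ext_iff.1 hi j
    simp only [Finset.mem_filter, Finset.mem_univ, true_and, Finset.mem_singleton] at this
    by_cases h : j = i
    · subst h
      have h' : p j ≠ q j := this.2 rfl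
      simp only [flip, Function.update_self]
      revert h'
      cases p j <;> cases q j <;> simp
    · simp only [flip, Function.update_of_ne h]
      by_contra h'
      exact h (this.1 h')
  · rintro ⟨i, rfl⟩
    refine ⟨i, Finset.ext fun j => ?_⟩
    rw [Finset.mem_filter, Finset.mem_singleton]
    by_cases h : j = i
    · subst h
      simp [flip]
    · simp [flip, h]

theorem flip_injective (p : BinString n) : Function.Injective (flip p) := by
  intro i j h
  by_contra hij
  have := congrFun h i
  simp [flip, hij] at this

theorem exists_neighborFinset (p : BinString n) :
    ∃ N : Finset (BinString n), N.card = n ∧ ∀ q, q ∈ N ↔ (hypercube n).Adj p q :=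
  ⟨Finset.univ.image (flip p), by simp [Finset.card_image_of_injective _ (flip_injective p)],
    fun q => by simp [adj_iff_exists_flip]⟩

/-- Three vertices of the `(n + 1)`-dimensional hypercube, not all in one facet, are joined by `n`
connected subgraphs. -/
theorem exists_packing_of_facet (e : Fin (n + 1)) {x y z : BinString (n + 1)} (hxy : x ≠ y)
    (hxe : x e = y e) (hxz : x e ≠ z e) :
    ∃ T : Fin n → (hypercube (n + 1)).Subgraph,
      (hypercube (n + 1)).IsConnectedPacking {x, y, z} T := by
  obtain ⟨x', hx⟩ := exists_eq_facet e x
  obtain ⟨y', hy⟩ := exists_eq_facet e y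
  obtain ⟨z', hz⟩ := exists_eq_facet e z
  rw [← hxe] at hy
  generalize x e = b at hx hy hxz
  generalize z e = c at hz hxz
  subst hx hy hz
  -- The representatives cross to the opposite facet, where a fan from `z'` collects them. The
  -- choice of `z'` as the vertex they avoid is arbitrary.
  obtain ⟨P, w, hP, hw, hwP⟩ := (vertexConnected n).exists_packing_pair_fin exists_neighborFinset
    (fun h => hxy (congrArg _ h)) z'
  obtain ⟨R, hR, hwR⟩ := (vertexConnected n).exists_packing_fan z' hw
  have hfacet : ∀ b (H : (hypercube n).Subgraph), (H.map (facet e b)).verts ⊆ {v | v e = b} := by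
    rintro b H _ ⟨v, -, rfl⟩
    exact facet_apply_self e b v
  have hK : (hypercube (n + 1)).IsConnectedPacking ∅
      fun i => (hypercube (n + 1)).pairSubgraph (facet e b (w i)) (facet e c (w i)) := by
    refine .of_subsingleton (by simp)
      (fun i => Subgraph.top_induce_pair_connected_of_adj (facet_adj_facet e hxz _)) (by simp) ?_
    rintro i j hij v ⟨h | h, h' | h'⟩
    · exact hij (hw (facet_injective e b (h.symm.trans h')))
    · exact hxz (by rw [← facet_apply_self e b (w i), ← h, h', facet_apply_self])
    · exact hxz (by rw [← facet_apply_self e b (w j), ← h', h, facet_apply_self])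
    · exact hij (hw (facet_injective e c (h.symm.trans h')))
  have h1 := hK.sup (w := fun i => facet e b (w i)) (hP.map (facet_injective e b))
    (fun i => hfacet b _) (by
      rintro i v ⟨h | h, h'⟩
      · exact h
      · exact absurd (h'.symm.trans (by rw [h, facet_apply_self])) hxz)
    (fun i => by simp) (fun i => ⟨_, (hwP i).1, rfl⟩)
  have h2 := h1.sup (w := fun i => facet e c (w i)) (hR.map (facet_injective e c))
    (fun i => hfacet c _) (by
      rintro i v ⟨(h | h) | h, h'⟩
      · exact absurd (h'.symm.trans (by rw [h, facet_apply_self])).symm hxz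
      · exact h
      · exact absurd ((hfacet b _ h).symm.trans h') hxz)
    (fun i => by simp) (fun i => ⟨_, hwR i, rfl⟩)
  have hS : ∅ ∪ facet e b '' {x', y'} ∪ facet e c '' {z'} =
      {facet e b x', facet e b y', facet e c z'} := by
    ext v
    simp [Set.image_pair]
    tauto
  exact ⟨_, hS ▸ h2⟩

/-- In a coordinate where `x` and `y` differ, `z` agrees with exactly one of them, so two of the
vertices share a facet that misses the third. -/
theorem exists_packing {x y z : BinString (n + 1)} (hxy : x ≠ y) (hxz : x ≠ z) (hyz : y ≠ z) :
    ∃ T : Fin n → (hypercube (n + 1)).Subgraph,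
      (hypercube (n + 1)).IsConnectedPacking {x, y, z} T := by
  obtain ⟨e, he⟩ := Function.ne_iff.1 hxy
  by_cases hz : x e = z e
  · rw [Set.pair_comm y z]
    exact exists_packing_of_facet e hxz hz he
  · have hyz' : y e = z e := by
      revert he hz
      cases x e <;> cases y e <;> cases z e <;> simp
    have : ({x, y, z} : Set (BinString (n + 1))) = {y, z, x} := by
      ext
      simp only [Set.mem_insert_iff, Set.mem_singleton_iff]
      tauto
    rw [this]
    exact exists_packing_of_facet e hyz hyz' he.symm

end hypercube

/-! ### Clusters, links and the lower bound by number of clusters met -/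

namespace HCN

variable {n : ℕ}

/-- The inclusion of a cluster. -/
def clusterHom (c : BinString n) : hypercube n →g HCN n where
  toFun p := (c, p)
  map_rel' h := Or.inl ⟨rfl, h⟩

theorem clusterHom_injective (c : BinString n) : Function.Injective (clusterHom c) :=
  Prod.mk_right_injective c

/-- The subgraph formed by a cluster. -/
def cluster (c : BinString n) : (HCN n).Subgraph := (⊤ : (hypercube n).Subgraph).map (clusterHom c)

theorem map_clusterHom_verts_subset (c : BinString n) (H : (hypercube n).Subgraph) :
    (H.map (clusterHom c)).verts ⊆ {v | v.1 = c} := by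
  rintro _ ⟨p, -, rfl⟩
  rfl

theorem mem_cluster {c : BinString n} {v : BinString n × BinString n} :
    v ∈ (cluster c).verts ↔ v.1 = c := by
  constructor
  · exact fun h => map_clusterHom_verts_subset c _ h
  · rintro rfl
    exact ⟨v.2, trivial, rfl⟩

theorem cluster_connected (c : BinString n) : (cluster c).Connected :=
  Subgraph.Connected.map_hom
    ⟨(Subgraph.topIso (G := hypercube n)).connected_iff.2 (hypercube.connected n)⟩ _

theorem adj_swap {a b : BinString n} (h : a ≠ b) : (HCN n).Adj (a, b) (b, a) :=
  Or.inr (Or.inr ⟨h, h, rfl, rfl⟩)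

theorem compl_ne (hn : n ≠ 0) (a : BinString n) : BinString.compl a ≠ a := by
  intro h
  have := congrFun h ⟨0, Nat.pos_of_ne_zero hn⟩
  simp [BinString.compl] at this

theorem adj_diag (hn : n ≠ 0) (a : BinString n) :
    (HCN n).Adj (a, a) (BinString.compl a, BinString.compl a) :=
  Or.inr (Or.inl ⟨(compl_ne hn a).symm, rfl, rfl, rfl⟩)

theorem pair_connected {u v : BinString n × BinString n} (h : (HCN n).Adj u v) :
    ((HCN n).pairSubgraph u v).Connected := Subgraph.top_induce_pair_connected_of_adj h

/-- A cluster together with the link to another cluster `a`. -/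
def clusterLink (c a : BinString n) : (HCN n).Subgraph :=
  cluster c ⊔ (HCN n).pairSubgraph (a, c) (c, a)

theorem clusterLink_connected {c a : BinString n} (h : a ≠ c) : (clusterLink c a).Connected :=
  (cluster_connected c).sup_of_mem (pair_connected (adj_swap h)) (v := (c, a))
    (mem_cluster.2 rfl) (by simp)

theorem mem_clusterLink {c a : BinString n} {v : BinString n × BinString n} :
    v ∈ (clusterLink c a).verts ↔ v.1 = c ∨ v = (a, c) := by
  simp only [clusterLink, Subgraph.verts_sup, Set.mem_union, mem_cluster, Subgraph.induce_verts,
    Set.mem_insert_iff, Set.mem_singleton_iff]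
  constructor
  · rintro (h | h | rfl)
    exacts [Or.inl h, Or.inr h, Or.inl rfl]
  · rintro (h | h)
    exacts [Or.inl h, Or.inr (Or.inl h)]

theorem clusterLink_sup_connected {c a : BinString n} {H : (HCN n).Subgraph} (hH : H.Connected)
    (h : a ≠ c) (hc : (cluster c).verts ⊆ H.verts) : (H ⊔ clusterLink c a).Connected :=
  hH.sup_of_mem (clusterLink_connected h) (v := (c, a)) (hc (mem_cluster.2 rfl))
    (mem_clusterLink.2 (Or.inl rfl))

/-- Two vertices in one cluster and one vertex in another. -/
theorem le_treeConnectivity_of_two_clusters {a b p q r : BinString n} (hab : a ≠ b) (hpq : p ≠ q) :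
    (n : ℕ∞) ≤ treeConnectivity (HCN n) {(a, p), (a, q), (b, r)} := by
  classical
  -- The representative `a` is excluded because the external edge of `(a, a)` leads to the
  -- complementary cluster, not to a cluster of its own label.
  obtain ⟨P, w, hP, hw, hwP⟩ := (hypercube.vertexConnected n).exists_packing_pair_fin
    hypercube.exists_neighborFinset hpq a
  have hwa : ∀ i, w i ≠ a := fun i => (hwP i).2
  -- Position at which the `i`-th subgraph enters cluster `b`: through cluster `w i` at `w i`, or at
  -- `a` by the direct edge if `w i = b`. Distinctness uses `w i ≠ a`.
  let u : Fin n → BinString n := fun i => if w i = b then a else w i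
  have hu : Function.Injective u := by
    intro i j h
    simp only [u] at h
    split_ifs at h with h1 h2 h2
    · exact hw (h1.trans h2.symm)
    · exact absurd h.symm (hwa j)
    · exact absurd h (hwa i)
    · exact hw h
  obtain ⟨R, hR, huR⟩ := (hypercube.vertexConnected n).exists_packing_fan r hu
  let K : Fin n → (HCN n).Subgraph := fun i =>
    if w i = b then (HCN n).pairSubgraph (a, b) (b, a)
    else clusterLink (w i) a ⊔ clusterLink (w i) b
  have hKc : ∀ i, (K i).Connected := by
    intro i
    by_cases h : w i = b
    · simp only [K, h, if_true]
      exact pair_connected (adj_swap hab)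
    · simp only [K, h, if_false]
      exact clusterLink_sup_connected (clusterLink_connected (hwa i).symm) (Ne.symm h)
        fun v hv => mem_clusterLink.2 (Or.inl (mem_cluster.1 hv))
  have hKv : ∀ i v, v ∈ (K i).verts ↔ v = (a, w i) ∨ v = (b, u i) ∨ (v.1 = w i ∧ w i ≠ b) := by
    intro i v
    by_cases h : w i = b
    · simp [K, u, h]
    · simp only [K, u, h, if_false, Subgraph.verts_sup, Set.mem_union, mem_clusterLink]
      tauto
  have hK : (HCN n).IsConnectedPacking ∅ K := by
    refine .of_subsingleton (by simp) hKc (by simp) ?_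
    rintro i j hij v ⟨h, h'⟩
    have hij' : w i ≠ w j := hw.ne hij
    rw [hKv] at h h'
    rcases h with rfl | rfl | h <;> rcases h' with h' | h' | h'
    · exact hij' (congrArg Prod.snd h')
    · exact hab (congrArg Prod.fst h')
    · exact hwa j h'.1.symm
    · exact hab (congrArg Prod.fst h').symm
    · exact hij (hu (congrArg Prod.snd h'))
    · exact h'.2 h'.1.symm
    · subst h'
      exact hwa i h.1.symm
    · subst h'
      exact h.2 h.1.symm
    · exact hij' (h.1.symm.trans h'.1)
  have h1 := hK.sup (w := fun i => (a, w i)) (hP.map (clusterHom_injective a))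
    (fun i => map_clusterHom_verts_subset a _) (by
      rintro i v ⟨h, h'⟩
      rw [hKv] at h
      rcases h with h | rfl | h
      · exact h
      · exact absurd h'.symm hab
      · exact absurd (h.1.symm.trans h') (hwa i))
    (fun i => (hKv _ _).2 (Or.inl rfl)) (fun i => ⟨_, (hwP i).1, rfl⟩)
  have h2 := h1.sup (w := fun i => (b, u i)) (hR.map (clusterHom_injective b))
    (fun i => map_clusterHom_verts_subset b _) (by
      rintro i v ⟨h | h, h'⟩
      · rw [hKv] at h
        rcases h with rfl | h | h
        · exact absurd h' hab
        · exact h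
        · exact absurd (h.1.symm.trans h') h.2
      · exact absurd ((map_clusterHom_verts_subset a _ h).symm.trans h') hab)
    (fun i => Or.inl ((hKv _ _).2 (Or.inr (Or.inl rfl)))) (fun i => ⟨_, huR i, rfl⟩)
  have hS : ∅ ∪ clusterHom a '' {p, q} ∪ clusterHom b '' {r} =
      ({(a, p), (a, q), (b, r)} : Set (BinString n × BinString n)) := by
    ext v
    simp [Set.image_pair, clusterHom]
    tauto
  rw [hS] at h2
  simpa using h2.le_treeConnectivity

/-- Three vertices in distinct clusters, when there are `n` further clusters. -/
theorem le_treeConnectivity_of_three_clusters {a b d p q r : BinString n} (hab : a ≠ b)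
    (had : a ≠ d) (hbd : b ≠ d) {u : Fin n → BinString n} (hu : Function.Injective u)
    (hua : ∀ i, u i ≠ a) (hub : ∀ i, u i ≠ b) (hud : ∀ i, u i ≠ d) :
    (n : ℕ∞) ≤ treeConnectivity (HCN n) {(a, p), (b, q), (d, r)} := by
  have hfan := fun s => (hypercube.vertexConnected n).exists_packing_fan s hu
  obtain ⟨P, hP, huP⟩ := hfan p
  obtain ⟨Q, hQ, huQ⟩ := hfan q
  obtain ⟨R, hR, huR⟩ := hfan r
  let K : Fin n → (HCN n).Subgraph := fun i =>
    clusterLink (u i) a ⊔ clusterLink (u i) b ⊔ clusterLink (u i) d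
  have hKv : ∀ i v, v ∈ (K i).verts ↔
      v.1 = u i ∨ v = (a, u i) ∨ v = (b, u i) ∨ v = (d, u i) := by
    intro i v
    simp only [K, Subgraph.verts_sup, Set.mem_union, mem_clusterLink]
    tauto
  have hK : (HCN n).IsConnectedPacking ∅ K := by
    refine .of_subsingleton (by simp) (fun i => ?_) (by simp) ?_
    · refine clusterLink_sup_connected (clusterLink_sup_connected
        (clusterLink_connected (hua i).symm) (hub i).symm fun v hv => ?_) (hud i).symm fun v hv => ?_
      · exact mem_clusterLink.2 (Or.inl (mem_cluster.1 hv))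
      · exact Or.inl (mem_clusterLink.2 (Or.inl (mem_cluster.1 hv)))
    · rintro i j hij v ⟨h, h'⟩
      have hij' : u i ≠ u j := hu.ne hij
      rw [hKv] at h h'
      have key : ∀ k, v.1 = u k → ¬ (v.1 = a ∨ v.1 = b ∨ v.1 = d) := by
        rintro k hk (h | h | h)
        · exact hua k (hk.symm.trans h)
        · exact hub k (hk.symm.trans h)
        · exact hud k (hk.symm.trans h)
      have split : ∀ k, (v = (a, u k) ∨ v = (b, u k) ∨ v = (d, u k)) →
          (v.1 = a ∨ v.1 = b ∨ v.1 = d) ∧ v.2 = u k := by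
        rintro k (rfl | rfl | rfl) <;> simp
      rcases h with h | h <;> rcases h' with h' | h'
      · exact hij' (h.symm.trans h')
      · exact key i h (split j h').1
      · exact key j h' (split i h).1
      · exact hij' ((split i h).2.symm.trans (split j h').2)
  have h1 := hK.sup (w := fun i => (a, u i)) (hP.map (clusterHom_injective a))
    (fun i => map_clusterHom_verts_subset a _) (by
      rintro i v ⟨h, h'⟩
      rw [hKv] at h
      rcases h with h | h | rfl | rfl
      · exact absurd (h.symm.trans h') (hua i)
      · exact h
      · exact absurd h'.symm hab
      · exact absurd h'.symm had)
    (fun i => (hKv _ _).2 (by simp)) (fun i => ⟨_, huP i, rfl⟩)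
  have h2 := h1.sup (w := fun i => (b, u i)) (hQ.map (clusterHom_injective b))
    (fun i => map_clusterHom_verts_subset b _) (by
      rintro i v ⟨h | h, h'⟩
      · rw [hKv] at h
        rcases h with h | rfl | h | rfl
        · exact absurd (h.symm.trans h') (hub i)
        · exact absurd h' hab
        · exact h
        · exact absurd h'.symm hbd
      · exact absurd ((map_clusterHom_verts_subset a _ h).symm.trans h') hab)
    (fun i => Or.inl ((hKv _ _).2 (by simp))) (fun i => ⟨_, huQ i, rfl⟩)
  have h3 := h2.sup (w := fun i => (d, u i)) (hR.map (clusterHom_injective d))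
    (fun i => map_clusterHom_verts_subset d _) (by
      rintro i v ⟨(h | h) | h, h'⟩
      · rw [hKv] at h
        rcases h with h | rfl | rfl | h
        · exact absurd (h.symm.trans h') (hud i)
        · exact absurd h' had
        · exact absurd h' hbd
        · exact h
      · exact absurd ((map_clusterHom_verts_subset a _ h).symm.trans h') had
      · exact absurd ((map_clusterHom_verts_subset b _ h).symm.trans h') hbd)
    (fun i => Or.inl (Or.inl ((hKv _ _).2 (by simp)))) (fun i => ⟨_, huR i, rfl⟩)
  have hS : ∅ ∪ clusterHom a '' {p} ∪ clusterHom b '' {q} ∪ clusterHom d '' {r} =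
      ({(a, p), (b, q), (d, r)} : Set (BinString n × BinString n)) := by
    ext v
    simp [clusterHom]
    tauto
  rw [hS] at h3
  simpa using h3.le_treeConnectivity

/-- The part of the network outside of a cluster. -/
def outside (a : BinString n) : (HCN n).Subgraph := (⊤ : (HCN n).Subgraph).induce {v | v.1 ≠ a}

/-- Each cluster other than `a` is connected and linked to the cluster of the complement of `a`,
which serves as a centre. -/
theorem outside_connected (hn : n ≠ 0) (a : BinString n) : (outside a).Connected := by
  rw [outside, ← connected_induce_iff]
  have hc := compl_ne hn a
  refine induce_connected_of_patches (BinString.compl a, a) hc fun {v} hv => ?_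
  have hconn : (cluster (BinString.compl a) ⊔ clusterLink v.1 (BinString.compl a)).Connected ∨
      v.1 = BinString.compl a := by
    by_cases h : v.1 = BinString.compl a
    · exact Or.inr h
    · exact Or.inl ((cluster_connected _).sup_of_mem (clusterLink_connected (Ne.symm h))
        (v := (BinString.compl a, v.1)) (mem_cluster.2 rfl) (mem_clusterLink.2 (Or.inr rfl)))
  rcases hconn with h | h
  · refine ⟨_, ?_, ?_, ?_, h.induce_verts.preconnected _ _⟩
    · rintro w (hw | hw)
      · rw [mem_cluster] at hw
        exact fun h => hc (hw.symm.trans h)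
      · rw [mem_clusterLink] at hw
        rcases hw with hw | rfl
        · exact fun h => hv (hw.symm.trans h)
        · exact hc
    · exact Or.inl (mem_cluster.2 rfl)
    · exact Or.inr (mem_clusterLink.2 (Or.inl rfl))
  · refine ⟨_, ?_, ?_, ?_, (cluster_connected (BinString.compl a)).induce_verts.preconnected _ _⟩
    · intro w hw
      rw [mem_cluster] at hw
      exact fun h => hc (hw.symm.trans h)
    · exact mem_cluster.2 rfl
    · exact mem_cluster.2 h

theorem exists_adj_outside (hn : n ≠ 0) (a p : BinString n) :
    ∃ v, (HCN n).Adj (a, p) v ∧ v.1 ≠ a := by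
  by_cases h : a = p
  · subst h
    exact ⟨_, adj_diag hn a, compl_ne hn a⟩
  · exact ⟨_, adj_swap h, Ne.symm h⟩

/-- Attaching a vertex of a cluster to a subgraph that has no edge in this cluster. -/
theorem exists_attach_outside (hn : n ≠ 0) (a p : BinString n) {H : (HCN n).Subgraph}
    (hH : H.Connected) (hout : (outside a).verts ⊆ H.verts)
    (hadj : ∀ u v, H.Adj u v → u.1 = a → v.1 ≠ a) :
    ∃ H' : (HCN n).Subgraph, H'.Connected ∧ H'.verts = insert (a, p) H.verts ∧
      ∀ u v, H'.Adj u v → u.1 = a → v.1 ≠ a := by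
  obtain ⟨e, he, hea⟩ := exists_adj_outside hn a p
  have heH : e ∈ H.verts := hout hea
  refine ⟨H ⊔ (HCN n).pairSubgraph (a, p) e,
    hH.sup_of_mem (pair_connected he) heH (by simp), ?_, ?_⟩
  · ext v
    simp only [Subgraph.verts_sup, Set.mem_union, Subgraph.induce_verts, Set.mem_insert_iff,
      Set.mem_singleton_iff]
    constructor
    · rintro (h | h | rfl)
      exacts [Or.inr h, Or.inl h, Or.inr heH]
    · rintro (h | h)
      exacts [Or.inr (Or.inl h), Or.inl h]
  · intro u v h hu hv
    rcases (Subgraph.sup_adj.1 h) with h | h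
    · exact hadj u v h hu hv
    · rcases h.fst_mem with h1 | rfl
      · rcases h.snd_mem with h2 | rfl
        · exact h.ne (h1.trans h2.symm)
        · exact hea hv
      · exact hea hu

/-- Three vertices in one cluster. -/
theorem le_treeConnectivity_of_cluster (hn : n ≠ 0) {a p q r : BinString n} (hpq : p ≠ q)
    (hpr : p ≠ r) (hqr : q ≠ r) :
    (n : ℕ∞) ≤ treeConnectivity (HCN n) {(a, p), (a, q), (a, r)} := by
  -- The additional subgraph: everything outside the cluster plus the external edges of the three
  -- vertices. Having no edge inside the cluster, it shares none with the packing of the cube.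
  obtain ⟨H₁, hc₁, hv₁, ha₁⟩ := exists_attach_outside hn a p (outside_connected hn a) subset_rfl
    (fun u v h hu => absurd hu h.fst_mem)
  obtain ⟨H₂, hc₂, hv₂, ha₂⟩ := exists_attach_outside hn a q hc₁
    (by rw [hv₁]; exact Set.subset_insert _ _) ha₁
  obtain ⟨H, hc, hv, ha⟩ := exists_attach_outside hn a r hc₂
    (by rw [hv₂, hv₁]; exact (Set.subset_insert _ _).trans (Set.subset_insert _ _)) ha₂
  rw [hv₂, hv₁] at hv
  obtain ⟨m, rfl⟩ := Nat.exists_eq_succ_of_ne_zero hn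
  obtain ⟨T, hT⟩ := hypercube.exists_packing hpq hpr hqr
  have h1 := hT.map (clusterHom_injective a)
  have hS : clusterHom a '' {p, q, r} = {(a, p), (a, q), (a, r)} := by
    rw [Set.image_insert_eq, Set.image_pair]
    rfl
  rw [hS] at h1
  have h2 := h1.option hc (by rw [hv]; intro v; simp; tauto) (by
    rintro i v ⟨h, h'⟩
    have hva := map_clusterHom_verts_subset a _ h'
    rw [hv] at h
    rcases h with h | h | h | h
    · simp [h]
    · simp [h]
    · simp [h]
    · exact absurd hva h) (fun i u v h h' => ha u v h
      (map_clusterHom_verts_subset a _ h'.fst_mem) (map_clusterHom_verts_subset a _ h'.snd_mem))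
  simpa using h2.le_treeConnectivity

/-! ### Degrees and the upper bound for the network -/

/-- There are `n` neighbours inside the cluster and a single external one: the complementary
diagonal vertex or the swapped pair. -/
theorem exists_neighborFinset (v : BinString n × BinString n) :
    ∃ N : Finset (BinString n × BinString n), N.card ≤ n + 1 ∧ ∀ w, (HCN n).Adj v w → w ∈ N := by
  classical
  obtain ⟨N, hN, hadj⟩ := hypercube.exists_neighborFinset v.2
  refine ⟨insert (if v.1 = v.2 then (BinString.compl v.1, BinString.compl v.1) else (v.2, v.1))
    (N.image fun p => (v.1, p)), ?_, ?_⟩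
  · refine (Finset.card_insert_le _ _).trans (Nat.add_le_add_right ?_ 1)
    exact Finset.card_image_le.trans hN.le
  · rintro ⟨c, p⟩ (⟨h1, h2⟩ | ⟨h1, h2, h3, h4⟩ | ⟨h1, h2, h3, h4⟩)
    · rw [Finset.mem_insert, Finset.mem_image]
      exact Or.inr ⟨p, (hadj p).2 h2, Prod.ext h1 rfl⟩
    · simp only at h1 h2 h3 h4
      rw [Finset.mem_insert, if_pos h2]
      exact Or.inl (by rw [h3, h4])
    · simp only at h1 h2 h3 h4
      rw [Finset.mem_insert, if_neg h2]
      exact Or.inl (by rw [h3, h4])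

theorem exists_treeConnectivity_le (hn : 2 ≤ n) :
    ∃ S : Finset (BinString n × BinString n), S.card = 3 ∧ treeConnectivity (HCN n) S ≤ n := by
  classical
  let p : BinString n := fun _ => false
  let i : Fin n := ⟨0, by omega⟩
  let j : Fin n := ⟨1, by omega⟩
  have hpi : (hypercube n).Adj p (hypercube.flip p i) := hypercube.adj_iff_exists_flip.2 ⟨i, rfl⟩
  have hpj : (hypercube n).Adj p (hypercube.flip p j) := hypercube.adj_iff_exists_flip.2 ⟨j, rfl⟩
  have hij : hypercube.flip p j ≠ hypercube.flip p i :=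
    (hypercube.flip_injective p).ne (by simp [i, j])
  obtain ⟨Nx, hcx, hNx⟩ := exists_neighborFinset (p, p)
  obtain ⟨Ny, hcy, hNy⟩ := exists_neighborFinset (p, hypercube.flip p i)
  have hx : (p, hypercube.flip p j) ≠ (p, p) := fun h => hpj.ne (congrArg Prod.snd h).symm
  have hy : (p, hypercube.flip p j) ≠ (p, hypercube.flip p i) :=
    fun h => hij (congrArg Prod.snd h)
  refine ⟨{(p, p), (p, hypercube.flip p i), (p, hypercube.flip p j)}, ?_, ?_⟩
  · exact Finset.card_eq_three.2
      ⟨_, _, _, fun h => hpi.ne (congrArg Prod.snd h), hx.symm, hy.symm, rfl⟩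
  · exact treeConnectivity_le_of_adj (x := (p, p)) (y := (p, hypercube.flip p i))
      (z := (p, hypercube.flip p j)) ((clusterHom p).map_adj hpi) (by simp) (by simp) (by simp)
      hx hy hNx hNy hcx hcy

end HCN

/-! ### Dimension two: three of the four clusters -/

namespace HCN

theorem square_adj : ∀ a u : BinString 2, a ≠ u → a ≠ BinString.compl u →
    hammingDist a u = 1 ∧ hammingDist a (BinString.compl u) = 1 := by
  decide

set_option synthInstance.maxHeartbeats 400000 in
set_option synthInstance.maxSize 2000 in
set_option maxRecDepth 20000 in
theorem square_cases : ∀ a b u r : BinString 2, a ≠ b → a ≠ u → a ≠ BinString.compl u → b ≠ u →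
    b ≠ BinString.compl u → r = a ∨ r = b ∨ r = u ∨ r = BinString.compl u := by
  decide

/-- In the square, two connected subgraphs meeting in `r`, one of which meets the antipodal pair
of `u`, while the other one contains the other two vertices. -/
theorem exists_square_subgraphs {a b u : BinString 2} (hab : a ≠ b) (hau : a ≠ u)
    (hau' : a ≠ BinString.compl u) (hbu : b ≠ u) (hbu' : b ≠ BinString.compl u) (r : BinString 2) :
    ∃ H K : (hypercube 2).Subgraph, H.Connected ∧ K.Connected ∧ r ∈ H.verts ∧ r ∈ K.verts ∧
      H.verts ∩ K.verts ⊆ {r} ∧ (u ∈ H.verts ∨ BinString.compl u ∈ H.verts) ∧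
      a ∈ K.verts ∧ b ∈ K.verts := by
  have huu : u ≠ BinString.compl u := (compl_ne (by simp) u).symm
  have pair_conn : ∀ v w : BinString 2, hammingDist v w = 1 →
      ((hypercube 2).pairSubgraph v w).Connected :=
    fun v w h => Subgraph.top_induce_pair_connected_of_adj h
  have top_conn : (⊤ : (hypercube 2).Subgraph).Connected :=
    ⟨(Subgraph.topIso (G := hypercube 2)).connected_iff.2 (hypercube.connected 2)⟩
  have path_conn : ((hypercube 2).pairSubgraph a (BinString.compl u) ⊔
      (hypercube 2).pairSubgraph b (BinString.compl u)).Connected :=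
    (pair_conn _ _ (square_adj a u hau hau').2).sup_of_mem (v := BinString.compl u)
      (pair_conn _ _ (square_adj b u hbu hbu').2) (by simp) (by simp)
  rcases square_cases a b u r hab hau hau' hbu hbu' with rfl | rfl | rfl | rfl
  · refine ⟨_, _, pair_conn _ _ (square_adj r u hau hau').1, path_conn, by simp, by simp, ?_,
      by simp, by simp, by simp⟩
    rintro v ⟨rfl | rfl, h⟩
    · rfl
    · rcases h with (h | h) | (h | h)
      exacts [h, absurd h huu, absurd h.symm hbu, absurd h huu]
  · refine ⟨_, _, pair_conn _ _ (square_adj r u hbu hbu').1, path_conn, by simp, by simp, ?_,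
      by simp, by simp, by simp⟩
    rintro v ⟨rfl | rfl, h⟩
    · rfl
    · rcases h with (h | h) | (h | h)
      exacts [absurd h.symm hau, absurd h huu, h, absurd h huu]
  · exact ⟨_, ⊤, Subgraph.singletonSubgraph_connected (v := r), top_conn, by simp, by simp,
      by simp, by simp, by simp, by simp⟩
  · exact ⟨_, ⊤, Subgraph.singletonSubgraph_connected (v := BinString.compl u), top_conn, by simp,
      by simp, by simp, by simp, by simp, by simp⟩

/-- With `d` the complement of `u`, the first subgraph uses cluster `u` as a hub and the second uses
cluster `d`. Inside cluster `d` they must share only `r`: the first needs `u` or `d` as a point of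
entry, the second needs `a` and `b` as exits, which is the splitting of the square into `H` and `K`.
-/
theorem le_treeConnectivity_two_of_compl {a b u : BinString 2} (hab : a ≠ b) (hau : a ≠ u)
    (had : a ≠ BinString.compl u) (hbu : b ≠ u) (hbd : b ≠ BinString.compl u) (p q r : BinString 2) :
    (2 : ℕ∞) ≤ treeConnectivity (HCN 2) {(a, p), (b, q), (BinString.compl u, r)} := by
  obtain ⟨H, K, hH, hK, hrH, hrK, hHK, hex, haK, hbK⟩ :=
    exists_square_subgraphs hab hau had hbu hbd r
  have hud : u ≠ BinString.compl u := (compl_ne (by simp) u).symm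
  have hdiag := (adj_diag (n := 2) (by simp) u).symm
  -- The diagonal edge has been recorded, so the complement can be forgotten.
  generalize BinString.compl u = d at *
  -- In clusters `a` and `b` alike, the first subgraph is attached at position `u` and the second at
  -- `d`.
  let w : Fin 2 → BinString 2 := ![u, d]
  have hw : Function.Injective w := by
    intro i j h
    fin_cases i <;> fin_cases j <;> first | rfl | exact absurd h hud | exact absurd h.symm hud
  have hfan := fun s => (hypercube.vertexConnected 2).exists_packing_fan s hw
  obtain ⟨P, hP, hwP⟩ := hfan p
  obtain ⟨Q, hQ, hwQ⟩ := hfan q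
  -- Cluster `u` reaches `H` by the swap edge if `u ∈ H`, and by the diagonal edge if `d ∈ H`.
  obtain ⟨E, hE, hEv⟩ : ∃ E : (HCN 2).Subgraph, E.Connected ∧
      ∀ v, v ∈ E.verts ↔ v.1 = u ∨ v ∈ (H.map (clusterHom d)).verts := by
    rcases hex with h | h
    · refine ⟨clusterLink u d ⊔ H.map (clusterHom d), (clusterLink_connected hud.symm).sup_of_mem
        (hH.map_hom _) (v := (d, u)) (mem_clusterLink.2 (Or.inr rfl)) ⟨u, h, rfl⟩, fun v => ?_⟩
      rw [Subgraph.verts_sup, Set.mem_union, mem_clusterLink]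
      constructor
      · rintro ((h' | rfl) | h')
        exacts [Or.inl h', Or.inr ⟨u, h, rfl⟩, Or.inr h']
      · rintro (h' | h')
        exacts [Or.inl (Or.inl h'), Or.inr h']
    · refine ⟨cluster u ⊔ (HCN 2).pairSubgraph (d, d) (u, u) ⊔ H.map (clusterHom d),
        ((cluster_connected u).sup_of_mem (pair_connected hdiag) (v := (u, u))
          (mem_cluster.2 rfl) (by simp)).sup_of_mem
        (hH.map_hom _) (v := (d, d)) (Or.inr (by simp)) ⟨d, h, rfl⟩, fun v => ?_⟩
      rw [Subgraph.verts_sup, Subgraph.verts_sup, Set.mem_union, Set.mem_union, mem_cluster]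
      constructor
      · rintro ((h' | (rfl | rfl)) | h')
        exacts [Or.inl h', Or.inr ⟨d, h, rfl⟩, Or.inl rfl, Or.inr h']
      · rintro (h' | h')
        exacts [Or.inl (Or.inl h'), Or.inr h']
  let T₀ : (HCN 2).Subgraph := E ⊔ clusterLink u a ⊔ clusterLink u b
  let T₁ : (HCN 2).Subgraph := K.map (clusterHom d) ⊔ (HCN 2).pairSubgraph (a, d) (d, a) ⊔
    (HCN 2).pairSubgraph (b, d) (d, b)
  have hT₀ : T₀.Connected := by
    refine clusterLink_sup_connected (clusterLink_sup_connected hE hau fun v hv => ?_) hbu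
      fun v hv => Or.inl ?_ <;> exact (hEv v).2 (Or.inl (mem_cluster.1 hv))
  have hT₁ : T₁.Connected :=
    ((hK.map_hom _).sup_of_mem (pair_connected (adj_swap had)) (v := (d, a)) ⟨a, haK, rfl⟩
      (by simp)).sup_of_mem (pair_connected (adj_swap hbd)) (v := (d, b)) (Or.inl ⟨b, hbK, rfl⟩)
      (by simp)
  have hv₀ : ∀ v, v ∈ T₀.verts ↔
      v.1 = u ∨ v ∈ (H.map (clusterHom d)).verts ∨ v = (a, u) ∨ v = (b, u) := by
    intro v
    simp only [T₀, Subgraph.verts_sup, Set.mem_union, hEv, mem_clusterLink]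
    tauto
  have hv₁ : ∀ v, v ∈ T₁.verts ↔
      v ∈ (K.map (clusterHom d)).verts ∨ v = (a, d) ∨ v = (b, d) := by
    intro v
    constructor
    · rintro ((h | (h | rfl)) | (h | rfl))
      exacts [Or.inl h, Or.inr (Or.inl h), Or.inl ⟨a, haK, rfl⟩, Or.inr (Or.inr h),
        Or.inl ⟨b, hbK, rfl⟩]
    · rintro (h | h | h)
      exacts [Or.inl (Or.inl h), Or.inl (Or.inr (Or.inl h)), Or.inr (Or.inl h)]
  have hsub := map_clusterHom_verts_subset (n := 2) d
  have hinter : T₀.verts ∩ T₁.verts ⊆ {(d, r)} := by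
    rintro v ⟨h, h'⟩
    rw [hv₀] at h
    rw [hv₁] at h'
    rcases h' with h' | rfl | rfl
    · have hvd : v.1 = d := hsub _ h'
      rcases h with h | h | rfl | rfl
      · exact absurd (h.symm.trans hvd) hud
      · obtain ⟨s, hs, rfl⟩ := h
        obtain ⟨t, ht, hts⟩ := h'
        rw [clusterHom_injective d hts] at ht
        have : s = r := hHK ⟨hs, ht⟩
        rw [this]
        rfl
      · exact absurd hvd had
      · exact absurd hvd hbd
    · rcases h with h | h | h | h
      · exact absurd h hau
      · exact absurd (hsub _ h) had
      · exact absurd (congrArg Prod.snd h).symm hud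
      · exact absurd (congrArg Prod.fst h) hab
    · rcases h with h | h | h | h
      · exact absurd h hbu
      · exact absurd (hsub _ h) hbd
      · exact absurd (congrArg Prod.fst h).symm hab
      · exact absurd (congrArg Prod.snd h).symm hud
  have h0 : (HCN 2).IsConnectedPacking {(d, r)} ![T₀, T₁] := by
    refine .of_subsingleton (by simp) ?_ ?_ ?_
    · simpa [Fin.forall_fin_two] using ⟨hT₀, hT₁⟩
    · simp only [Fin.forall_fin_two, Set.singleton_subset_iff]
      exact ⟨(hv₀ _).2 (Or.inr (Or.inl ⟨r, hrH, rfl⟩)), (hv₁ _).2 (Or.inl ⟨r, hrK, rfl⟩)⟩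
    · intro i j hij
      fin_cases i <;> fin_cases j
      · exact absurd rfl hij
      · exact hinter
      · rw [Set.inter_comm]
        exact hinter
      · exact absurd rfl hij
  have hmem : ∀ i v, v ∈ (![T₀, T₁] i).verts →
      v.1 = u ∨ v.1 = d ∨ v = (a, w i) ∨ v = (b, w i) := by
    intro i v hv
    fin_cases i
    · rcases (hv₀ v).1 hv with h | h | h | h
      exacts [Or.inl h, Or.inr (Or.inl (hsub _ h)), Or.inr (Or.inr (Or.inl h)),
        Or.inr (Or.inr (Or.inr h))]
    · rcases (hv₁ v).1 hv with h | h | h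
      exacts [Or.inr (Or.inl (hsub _ h)), Or.inr (Or.inr (Or.inl h)), Or.inr (Or.inr (Or.inr h))]
  have h1 := h0.sup (w := fun i => (a, w i)) (hP.map (clusterHom_injective a))
    (fun i => map_clusterHom_verts_subset a _) (by
      rintro i v ⟨h, h'⟩
      rcases hmem i v h with h | h | h | rfl
      · exact absurd (h'.symm.trans h) hau
      · exact absurd (h'.symm.trans h) had
      · exact h
      · exact absurd h'.symm hab)
    (by
      rw [Fin.forall_fin_two]
      exact ⟨(hv₀ _).2 (by simp [w]), (hv₁ _).2 (by simp [w])⟩)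
    (fun i => ⟨_, hwP i, rfl⟩)
  have h2 := h1.sup (w := fun i => (b, w i)) (hQ.map (clusterHom_injective b))
    (fun i => map_clusterHom_verts_subset b _) (by
      rintro i v ⟨h | h, h'⟩
      · rcases hmem i v h with h | h | rfl | h
        · exact absurd (h'.symm.trans h) hbu
        · exact absurd (h'.symm.trans h) hbd
        · exact absurd h' hab
        · exact h
      · exact absurd ((map_clusterHom_verts_subset a _ h).symm.trans h') hab)
    (by
      rw [Fin.forall_fin_two]
      exact ⟨Or.inl ((hv₀ _).2 (by simp [w])), Or.inl ((hv₁ _).2 (by simp [w]))⟩)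
    (fun i => ⟨_, hwQ i, rfl⟩)
  have hS : {(d, r)} ∪ clusterHom a '' {p} ∪ clusterHom b '' {q} =
      ({(a, p), (b, q), (d, r)} : Set (BinString 2 × BinString 2)) := by
    ext v
    simp [clusterHom]
    tauto
  rw [hS] at h2
  simpa using h2.le_treeConnectivity

-- Only one of the four strings is left for `u`, and its complement, being different from it, is
-- among the other three.
set_option synthInstance.maxHeartbeats 400000 in
set_option synthInstance.maxSize 2000 in
set_option maxRecDepth 20000 in
theorem exists_fourth_cluster : ∀ a b d : BinString 2, a ≠ b → a ≠ d → b ≠ d →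
    ∃ u, a ≠ u ∧ b ≠ u ∧ d ≠ u ∧
      (d = BinString.compl u ∨ b = BinString.compl u ∨ a = BinString.compl u) := by
  decide

theorem le_treeConnectivity_two {a b d : BinString 2} (hab : a ≠ b) (had : a ≠ d) (hbd : b ≠ d)
    (p q r : BinString 2) :
    (2 : ℕ∞) ≤ treeConnectivity (HCN 2) {(a, p), (b, q), (d, r)} := by
  obtain ⟨u, hau, hbu, hdu, rfl | rfl | rfl⟩ := exists_fourth_cluster a b d hab had hbd
  · exact le_treeConnectivity_two_of_compl hab hau had hbu hbd p q r
  · rw [Set.pair_comm]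
    exact le_treeConnectivity_two_of_compl had hau hab hdu hbd.symm p r q
  · rw [Set.insert_comm, Set.pair_comm]
    exact le_treeConnectivity_two_of_compl hbd hbu hab.symm hdu had.symm q r p

/-! ### Counting further clusters, and the conclusion -/

theorem exists_further_clusters {n : ℕ} (hn : 3 ≤ n) (a b d : BinString n) :
    ∃ u : Fin n → BinString n, Function.Injective u ∧
      (∀ i, u i ≠ a) ∧ (∀ i, u i ≠ b) ∧ ∀ i, u i ≠ d := by
  classical
  -- This fails for `n = 2`, hence the separate treatment of that dimension.
  have hpow : n + 3 ≤ 2 ^ n := by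
    induction n, hn using Nat.le_induction with
    | base => norm_num
    | succ k _ ih =>
      -- The types of `a`, `b`, `d` depend on `n`, so the induction hypothesis quantifies over them;
      -- any strings will do.
      have := ih (fun _ => false) (fun _ => false) (fun _ => false)
      rw [pow_succ]
      omega
  have hcard : n ≤ (({a, b, d} : Finset (BinString n))ᶜ).card := by
    have h3 : ({a, b, d} : Finset (BinString n)).card ≤ 3 := Finset.card_le_three
    have hc : Fintype.card (BinString n) = 2 ^ n := by simp
    rw [Finset.card_compl, hc]
    omega
  obtain ⟨U, hU, hUc⟩ := Finset.exists_subset_card_eq hcard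
  let e := (U.equivFinOfCardEq hUc).symm
  have hmem : ∀ i, (e i : BinString n) ≠ a ∧ (e i : BinString n) ≠ b ∧ (e i : BinString n) ≠ d :=
    fun i => by simpa using hU (e i).2
  exact ⟨fun i => e i, Subtype.val_injective.comp e.injective, fun i => (hmem i).1,
    fun i => (hmem i).2.1, fun i => (hmem i).2.2⟩

theorem le_treeConnectivity {n : ℕ} (hn : 2 ≤ n) {x y z : BinString n × BinString n} (hxy : x ≠ y)
    (hxz : x ≠ z) (hyz : y ≠ z) : (n : ℕ∞) ≤ treeConnectivity (HCN n) {x, y, z} := by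
  obtain ⟨a, p⟩ := x
  obtain ⟨b, q⟩ := y
  obtain ⟨d, r⟩ := z
  by_cases hab : a = b
  · subst hab
    by_cases had : a = d
    · subst had
      exact le_treeConnectivity_of_cluster (by omega) (fun h => hxy (h ▸ rfl))
        (fun h => hxz (h ▸ rfl)) (fun h => hyz (h ▸ rfl))
    · exact le_treeConnectivity_of_two_clusters had (fun h => hxy (h ▸ rfl))
  by_cases had : a = d
  · subst had
    rw [Set.pair_comm]
    exact le_treeConnectivity_of_two_clusters hab (fun h => hxz (h ▸ rfl))
  by_cases hbd : b = d
  · subst hbd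
    rw [Set.insert_comm, Set.pair_comm]
    exact le_treeConnectivity_of_two_clusters (Ne.symm hab) (fun h => hyz (h ▸ rfl))
  rcases hn.eq_or_lt with rfl | hn
  · exact le_treeConnectivity_two hab had hbd p q r
  · obtain ⟨u, hu, hua, hub, hud⟩ := exists_further_clusters hn a b d
    exact le_treeConnectivity_of_three_clusters hab had hbd hu hua hub hud

end HCN

theorem corollary4p2 (n : ℕ) (hn : 2 ≤ n) :
    generalizedConnectivity (HCN n) 3 = (n : ℕ∞) := by
  apply le_antisymm
  · obtain ⟨S, hS, hle⟩ := HCN.exists_treeConnectivity_le hn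
    exact (iInf₂_le S hS).trans hle
  · refine le_iInf₂ fun S hS => ?_
    classical
    obtain ⟨x, y, z, hxy, hxz, hyz, rfl⟩ := Finset.card_eq_three.1 hS
    simpa using HCN.le_treeConnectivity hn hxy hxz hyz
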